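/- Let $R$ be an associative ring with identity; modules are left $R$-modules and complexes are cochain complexes indexed by $\mathbb{Z}$. A short exact sequence of modules is pure exact if it stays exact under $M\otimes_R-$ for every right $R$-module $M$; its first map is then called a pure monomorphism and its second map a pure epimorphism. A complex $X$ is pure exact if for every $n$ the differentials $d^{n-1}$ and $d^n$ each factor as a pure epimorphism followed by a pure monomorphism and the sequence $0\to\operatorname{Ker}d^n\to X^n\to\operatorname{Coker}d^{n-1}\to 0$ is pure exact. A module is pure injective if it is injective with respect to pure exact sequences. A cochain map is a pure quasi-isomorphism if its mapping cone is pure exact. For complexes $E, I$, $\operatorname{Hom}_R(E,I)$ denotes the total complex of $\mathbb{Z}$-modules with $\prod_{i\in\mathbb{Z}}\operatorname{Hom}_R(E^i,I^{i+n})$ in degree $n$ and differential $\varphi\mapsto d_I\circ\varphi-(-1)^n\varphi\circ d_E$. Theorem 5.2. Let $X$ be a bounded above complex of $R$-modules, that is, there is $b\in\mathbb{Z}$ with $X^i=0$ for all $i>b$. Then $X$ has a pure injective resolution: there exist a complex $I$ all of whose terms $I^n$ are pure injective $R$-modules and a pure quasi-isomorphism $f:X\to I$, such that for every pure exact complex $E$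 of $R$-modules the complex $\operatorname{Hom}_R(E,I)$ of $\mathbb{Z}$-modules is pure exact. -/

import Mathlib

open CategoryTheory TensorProduct

universe u v

namespace PureHomology

section Tensor

variable (R : Type u) [Ring R]

/-- The relations `(m r) ⊗ n = m ⊗ (r n)` inside `M ⊗_ℤ N`, for a right `R`-module `M`
(a module over `Rᵐᵒᵖ`) and a left `R`-module `N`. -/
def balancedRel (M : Type*) [AddCommGroup M] [Module Rᵐᵒᵖ M]
    (N : Type*) [AddCommGroup N] [Module R N] : Submodule ℤ (M ⊗[ℤ] N) :=
  Submodule.span ℤ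
    {t | ∃ (m : M) (r : R) (n : N), t = (MulOpposite.op r • m) ⊗ₜ[ℤ] n - m ⊗ₜ[ℤ] (r • n)}

/-- The tensor product `M ⊗_R N` (an abelian group) of a right and a left module over a ring
that need not be commutative. -/
abbrev BalancedTensor (M : Type*) [AddCommGroup M] [Module Rᵐᵒᵖ M]
    (N : Type*) [AddCommGroup N] [Module R N] :=
  (M ⊗[ℤ] N) ⧸ balancedRel R M N

variable {R}

theorem balancedRel_le_comap (M : Type*) [AddCommGroup M] [Module Rᵐᵒᵖ M]
    {A B : Type*} [AddCommGroup A] [Module R A] [AddCommGroup B] [Module R B] (f : A →ₗ[R] B) :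
    balancedRel R M A ≤
      (balancedRel R M B).comap (LinearMap.lTensor M f.toAddMonoidHom.toIntLinearMap) := by
  refine Submodule.span_le.2 ?_
  rintro _ ⟨m, r, a, rfl⟩
  refine Submodule.subset_span ⟨m, r, f a, ?_⟩
  simp

/-- The map `M ⊗_R f : M ⊗_R A → M ⊗_R B`. -/
def balancedMap (M : Type*) [AddCommGroup M] [Module Rᵐᵒᵖ M]
    {A B : Type*} [AddCommGroup A] [Module R A] [AddCommGroup B] [Module R B] (f : A →ₗ[R] B) :
    BalancedTensor R M A →ₗ[ℤ] BalancedTensor R M B :=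
  Submodule.mapQ _ _ (LinearMap.lTensor M f.toAddMonoidHom.toIntLinearMap)
    (balancedRel_le_comap M f)

end Tensor

section Pure

variable {R : Type u} [Ring R]

/-- The sequence `0 → A → B → C → 0` of left `R`-modules is exact and stays exact under
`M ⊗_R -` for every right `R`-module `M`. -/
structure IsPureShortExact {A B C : Type v} [AddCommGroup A] [Module R A]
    [AddCommGroup B] [Module R B] [AddCommGroup C] [Module R C]
    (f : A →ₗ[R] B) (g : B →ₗ[R] C) : Prop where
  injective : Function.Injective f
  exact : Function.Exact f g
  surjective : Function.Surjective g
  tensor : ∀ (M : Type (max u v)) [AddCommGroup M] [Module Rᵐᵒᵖ M],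
    Function.Injective (balancedMap M f) ∧
      Function.Exact (balancedMap M f) (balancedMap M g) ∧
      Function.Surjective (balancedMap M g)

/-- `f` is the monomorphism of a pure exact sequence. -/
def IsPureMono {A B : ModuleCat.{v} R} (f : A ⟶ B) : Prop :=
  ∃ (C : ModuleCat.{v} R) (g : B ⟶ C), IsPureShortExact f.hom g.hom

/-- `g` is the epimorphism of a pure exact sequence. -/
def IsPureEpi {B C : ModuleCat.{v} R} (g : B ⟶ C) : Prop :=
  ∃ (A : ModuleCat.{v} R) (f : A ⟶ B), IsPureShortExact f.hom g.hom

/-- `d` decomposes as a pure epimorphism followed by a pure monomorphism. -/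
def IsPureDecomposable {A B : ModuleCat.{v} R} (d : A ⟶ B) : Prop :=
  ∃ (D : ModuleCat.{v} R) (p : A ⟶ D) (i : D ⟶ B), IsPureEpi p ∧ IsPureMono i ∧ p ≫ i = d

/-- Pure exactness of a cochain complex at the spot `n`: the differentials into and out of `X^n`
decompose in the pure exact structure, and `0 → Ker d^n → X^n → Coker d^{n-1} → 0` is
pure exact. -/
structure IsPureExactAt (X : CochainComplex (ModuleCat.{v} R) ℤ) (n : ℤ) : Prop where
  decomposable_prev : IsPureDecomposable (X.d (n - 1) n)
  decomposable_next : IsPureDecomposable (X.d n (n + 1))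
  ses : IsPureShortExact (LinearMap.ker (X.d n (n + 1)).hom).subtype
    (LinearMap.range (X.d (n - 1) n).hom).mkQ

/-- A pure exact complex. -/
def IsPureExact (X : CochainComplex (ModuleCat.{v} R) ℤ) : Prop :=
  ∀ n : ℤ, IsPureExactAt X n

/-- A pure injective module: one that is injective with respect to pure exact sequences. -/
def IsPureInjective (I : ModuleCat.{v} R) : Prop :=
  ∀ ⦃A B : ModuleCat.{v} R⦄ (f : A ⟶ B), IsPureMono f →
    ∀ h : A ⟶ I, ∃ k : B ⟶ I, f ≫ k = h

/-- A cochain map whose mapping cone is pure exact. -/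
def IsPureQuasiIso {X Y : CochainComplex (ModuleCat.{v} R) ℤ} (f : X ⟶ Y) : Prop :=
  IsPureExact (CochainComplex.mappingCone f)

/-- An abelian group as a `ℤ`-module. -/
def toIntModule : AddCommGrpCat.{v} ⥤ ModuleCat.{v} ℤ where
  obj A := ModuleCat.of ℤ A
  map f := ModuleCat.ofHom f.hom.toIntLinearMap

instance : toIntModule.{v}.Additive where

/-- The total complex `Hom_R(X, Y)`, a cochain complex of `ℤ`-modules: in degree `n` it is
`∏ i, Hom_R(X^i, Y^{i+n})`, with differential `d φ = d_Y ∘ φ - (-1)^n φ ∘ d_X`. -/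
noncomputable def homComplex (X Y : CochainComplex (ModuleCat.{v} R) ℤ) :
    CochainComplex (ModuleCat.{v} ℤ) ℤ :=
  (toIntModule.mapHomologicalComplex _).obj (CochainComplex.HomComplex X Y)

/-- `f : X ⟶ I` is a pure injective resolution of `X`: a pure quasi-isomorphism to a complex of
pure injective modules such that `Hom_R(-, I)` preserves pure exact complexes. -/
structure IsPureInjectiveResolution {X I : CochainComplex (ModuleCat.{v} R) ℤ}
    (f : X ⟶ I) : Prop where
  quasiIso : IsPureQuasiIso f
  pureInjective : ∀ n : ℤ, IsPureInjective (I.X n)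
  hom_pureExact : ∀ E : CochainComplex (ModuleCat.{v} R) ℤ,
    IsPureExact E → IsPureExact (homComplex E I)

end Pure

end PureHomology

/-! Purity can be tested on finite matrices: by the equational criterion for vanishing in a tensor
product, a sequence that is exact modulo every finite matrix over `R` (`TupleExact`) stays exact
under `M ⊗_R -` for every `M` (`TupleExact.tensor`).

For a complex `C` with boundaries `B`, the quotient `C^n / B^n` embeds purely in its double
character module (`toDoubleDual_pure`). The resulting ghost map is a cochain map from `C` to a
shifted complex `T` with zero differential, and an element with image in `T` divisible by a matrix
is a boundary modulo that matrix (`tupleExact_ghostMap`). Hence the projection from the fiber, with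
terms `C^n × T^n`, back to `C` vanishes on homology modulo every matrix. Iterating from `X` gives a
tower all of whose transition maps vanish in this sense. A Mittag-Leffler argument makes its limit
`L`, with terms `X^n × ∏ T_l^n`, exact modulo matrices (`tupleExact_ghostD`). The kernel of `L → X`,
shifted, is the resolution `I`, and the cone of `X → I` is the shift of `L`.

The terms of `I` are products of character modules, hence pure injective. The differential of `I` is
strictly triangular for the product decomposition, so on the lowest nonzero component the
differential of `Hom_R(E, I)` is precomposition with `d_E` up to sign. Cocycles are therefore
bounded one component at a time, by extension along the pure inclusion of the cycles of `E`. For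
purity over `ℤ`, tuples subject to integer relations are extended together: in a character module
such tuples form another character module (`isTuplePureInjective_leftDual`). -/

namespace PureHomology

/-! ### Tensor products over a noncommutative ring and the equational criterion. -/

section BalancedTensor

variable {R : Type u} [Ring R] {M : Type*} [AddCommGroup M] [Module Rᵐᵒᵖ M]
  {A B C : Type*} [AddCommGroup A] [Module R A] [AddCommGroup B] [Module R B]
  [AddCommGroup C] [Module R C]

/-- The pure tensor `m ⊗ a` in `M ⊗_R A`. -/
def pureTensor (m : M) (a : A) : BalancedTensor R M A :=
  Submodule.Quotient.mk (m ⊗ₜ[ℤ] a)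

theorem pureTensor_add_left (m m' : M) (a : A) :
    pureTensor (R := R) (m + m') a = pureTensor m a + pureTensor m' a := by
  simp [pureTensor, TensorProduct.add_tmul]

theorem pureTensor_add_right (m : M) (a a' : A) :
    pureTensor (R := R) m (a + a') = pureTensor m a + pureTensor m a' := by
  simp [pureTensor, TensorProduct.tmul_add]

variable (R) in
/-- The pure tensor as a biadditive map. -/
def pureTensorHom (M A : Type*) [AddCommGroup M] [Module Rᵐᵒᵖ M] [AddCommGroup A] [Module R A] :
    M →+ A →+ BalancedTensor R M A :=
  AddMonoidHom.mk' (fun m => AddMonoidHom.mk' (pureTensor m) (pureTensor_add_right m))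
    (fun m m' => AddMonoidHom.ext fun a => pureTensor_add_left m m' a)

@[simp] theorem pureTensorHom_apply (m : M) (a : A) :
    pureTensorHom R M A m a = pureTensor m a := rfl

theorem pureTensor_sum_right {ι : Type*} (s : Finset ι) (m : M) (a : ι → A) :
    pureTensor (R := R) m (∑ i ∈ s, a i) = ∑ i ∈ s, pureTensor m (a i) :=
  map_sum (pureTensorHom R M A m) a s

theorem pureTensor_sum_left {ι : Type*} (s : Finset ι) (m : ι → M) (a : A) :
    pureTensor (R := R) (∑ i ∈ s, m i) a = ∑ i ∈ s, pureTensor (m i) a := by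
  exact map_sum ((pureTensorHom R M A).flip a) m s

theorem pureTensor_zero_left (a : A) : pureTensor (R := R) (0 : M) a = 0 := by
  simp [pureTensor]

theorem pureTensor_zero_right (m : M) : pureTensor (R := R) m (0 : A) = 0 := by
  simp [pureTensor]

theorem pureTensor_smul (m : M) (r : R) (a : A) :
    pureTensor (R := R) m (r • a) = pureTensor (MulOpposite.op r • m) a := by
  symm
  rw [pureTensor, pureTensor, Submodule.Quotient.eq]
  exact Submodule.subset_span ⟨m, r, a, rfl⟩

@[simp] theorem balancedMap_pureTensor (f : A →ₗ[R] B) (m : M) (a : A) :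
    balancedMap M f (pureTensor m a) = pureTensor m (f a) :=
  rfl

theorem BalancedTensor.induction {p : BalancedTensor R M A → Prop}
    (h0 : p 0) (h1 : ∀ m a, p (pureTensor m a)) (h2 : ∀ x y, p x → p y → p (x + y))
    (t : BalancedTensor R M A) : p t := by
  obtain ⟨s, rfl⟩ := Submodule.Quotient.mk_surjective _ t
  induction s using TensorProduct.induction_on with
  | zero => simpa using h0
  | tmul m a => exact h1 m a
  | add x y hx hy => simpa using h2 _ _ hx hy

theorem BalancedTensor.hom_ext {P : Type*} [AddCommGroup P] {f g : BalancedTensor R M A →ₗ[ℤ] P}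
    (h : ∀ m a, f (pureTensor m a) = g (pureTensor m a)) : f = g := by
  refine LinearMap.ext fun t => ?_
  induction t using BalancedTensor.induction with
  | h0 => simp
  | h1 m a => exact h m a
  | h2 x y hx hy => simp [hx, hy]

theorem balancedMap_comp (f : A →ₗ[R] B) (g : B →ₗ[R] C) (t : BalancedTensor R M A) :
    balancedMap M g (balancedMap M f t) = balancedMap M (g ∘ₗ f) t := by
  have : balancedMap M g ∘ₗ balancedMap M f = balancedMap M (g ∘ₗ f) :=
    BalancedTensor.hom_ext (by simp)
  exact LinearMap.congr_fun this t

theorem balancedMap_zero (t : BalancedTensor R M A) :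
    balancedMap M (0 : A →ₗ[R] B) t = 0 := by
  have : balancedMap M (0 : A →ₗ[R] B) = 0 :=
    BalancedTensor.hom_ext (by simp [pureTensor_zero_right])
  exact LinearMap.congr_fun this t

/-- The map out of `M ⊗_R A` given by a balanced biadditive map. -/
def balancedLift {P : Type*} [AddCommGroup P] (β : M →+ A →+ P)
    (hβ : ∀ (m : M) (r : R) (a : A), β m (r • a) = β (MulOpposite.op r • m) a) :
    BalancedTensor R M A →ₗ[ℤ] P :=
  Submodule.liftQ _
    (TensorProduct.lift (LinearMap.mk₂ ℤ (fun m a => β m a) (by simp) (by simp) (by simp)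
      (by simp)))
    (by
      refine Submodule.span_le.2 ?_
      rintro _ ⟨m, r, a, rfl⟩
      exact (map_sub _ _ _).trans (sub_eq_zero.2 (hβ m r a).symm))

@[simp] theorem balancedLift_pureTensor {P : Type*} [AddCommGroup P] (β : M →+ A →+ P)
    (hβ : ∀ (m : M) (r : R) (a : A), β m (r • a) = β (MulOpposite.op r • m) a) (m : M) (a : A) :
    balancedLift β hβ (pureTensor m a) = β m a :=
  rfl

theorem balancedMap_surjective (M : Type*) [AddCommGroup M] [Module Rᵐᵒᵖ M] {f : A →ₗ[R] B}
    (hf : Function.Surjective f) : Function.Surjective (balancedMap M f) := by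
  intro t
  induction t using BalancedTensor.induction with
  | h0 => exact ⟨0, map_zero _⟩
  | h1 m b =>
    obtain ⟨a, rfl⟩ := hf b
    exact ⟨pureTensor m a, by simp⟩
  | h2 x y hx hy =>
    obtain ⟨x, rfl⟩ := hx
    obtain ⟨y, rfl⟩ := hy
    exact ⟨x + y, map_add _ _ _⟩

theorem balancedMap_exact (M : Type*) [AddCommGroup M] [Module Rᵐᵒᵖ M] {f : A →ₗ[R] B}
    {g : B →ₗ[R] C} (hfg : Function.Exact f g) (hg : Function.Surjective g) :
    Function.Exact (balancedMap M f) (balancedMap M g) := by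
  let Q := BalancedTensor R M B ⧸ LinearMap.range (balancedMap M f)
  let q : BalancedTensor R M B →ₗ[ℤ] Q := Submodule.mkQ _
  have hq : ∀ (m : M) (b b' : B), g b = g b' → q (pureTensor m b) = q (pureTensor m b') := by
    intro m b b' h
    obtain ⟨a, ha⟩ := (hfg (b - b')).1 (by simp [h])
    refine (Submodule.Quotient.eq _).2 ⟨pureTensor m a, ?_⟩
    have := map_sub (pureTensorHom R M B m) b b'
    simpa [ha] using this
  -- A set-theoretic section is enough: by `hq` the class of `m ⊗ b` depends only on `g b`, which
  -- forces additivity and balancedness.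
  choose σ hσ using hg
  let β : M →+ C →+ Q := AddMonoidHom.mk' (fun m => AddMonoidHom.mk'
      (fun c => q (pureTensor m (σ c))) (fun c c' => by
        rw [← map_add, ← pureTensor_add_right]
        exact hq _ _ _ (by simp [hσ])))
      (fun m m' => AddMonoidHom.ext fun c => by simp [pureTensor_add_left])
  let s : BalancedTensor R M C →ₗ[ℤ] Q := balancedLift β (fun m r c => by
    simp only [β, AddMonoidHom.mk'_apply]
    rw [← pureTensor_smul]
    exact hq _ _ _ (by simp [hσ]))
  have hs : s ∘ₗ balancedMap M g = q := BalancedTensor.hom_ext fun m b => by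
    simp only [s, LinearMap.comp_apply, balancedMap_pureTensor, balancedLift_pureTensor, β,
      AddMonoidHom.mk'_apply]
    exact hq _ _ _ (by simp [hσ])
  intro t
  constructor
  · intro ht
    have h := LinearMap.congr_fun hs t
    rw [LinearMap.comp_apply, ht, map_zero] at h
    exact (Submodule.Quotient.mk_eq_zero _).1 h.symm
  · rintro ⟨a, rfl⟩
    rw [balancedMap_comp, hfg.linearMap_comp_eq_zero, balancedMap_zero]

/-- Every element of `M ⊗_R A` is a finite sum of pure tensors with distinct left factors. -/
theorem exists_eq_finsupp_sum (t : BalancedTensor R M A) :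
    ∃ w : M →₀ A, t = w.sum fun m a => pureTensor m a := by
  induction t using BalancedTensor.induction with
  | h0 => exact ⟨0, by simp⟩
  | h1 m a => exact ⟨Finsupp.single m a, by simp [pureTensor_zero_right]⟩
  | h2 x y hx hy =>
    obtain ⟨x, rfl⟩ := hx
    obtain ⟨y, rfl⟩ := hy
    classical
    exact ⟨x + y, (Finsupp.sum_add_index (by simp [pureTensor_zero_right])
      (by simp [pureTensor_add_right])).symm⟩

/-- The equational criterion for vanishing of an element of `M ⊗_R A`. -/
theorem exists_relations_of_sum_eq_zero (w : M →₀ A)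
    (hw : (w.sum fun m a => pureTensor (R := R) m a) = 0) :
    ∃ (n : ℕ) (ρ : Fin n → M →₀ R) (b : Fin n → A),
      (∀ j, ((ρ j).sum fun m r => MulOpposite.op r • m) = 0) ∧
        ∀ m, w m = ∑ j, ρ j m • b j := by
  classical
  let K : Set (M →₀ R) := {ρ | (ρ.sum fun m r => MulOpposite.op r • m) = 0}
  let T : R →+ M →+ M := AddMonoidHom.mk' (fun r => AddMonoidHom.mk'
    (fun m => MulOpposite.op r • m) (by simp)) (fun r s => by ext m; simp [add_smul])
  let ev : (M →₀ R) →+ M := Finsupp.liftAddHom (fun m => T.flip m)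
  have hK : ∀ ρ, ρ ∈ K ↔ ev ρ = 0 := fun ρ => Iff.rfl
  have hev : ∀ m r, ev (Finsupp.single m r) = MulOpposite.op r • m := fun m r =>
    Finsupp.sum_single_index (by simp)
  let o : (M →₀ R) → A → (M →₀ A) := fun ρ b => ρ.mapRange (fun r => r • b) (zero_smul _ _)
  -- The tensor product maps to formal sums modulo `S`, so a sum vanishing in it lies in `S`; the
  -- generators involved are the required relations.
  let S : Submodule ℤ (M →₀ A) := Submodule.span ℤ {z | ∃ ρ ∈ K, ∃ b, z = o ρ b}
  let q := S.mkQ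
  have hq : ∀ x y : M →₀ A, (∃ ρ ∈ K, ∃ b, x - y = o ρ b) → q x = q y := fun x y h =>
    (Submodule.Quotient.eq _).2 (Submodule.subset_span h)
  let β : M →+ A →+ ((M →₀ A) ⧸ S) := AddMonoidHom.mk' (fun m => AddMonoidHom.mk'
      (fun a => q (Finsupp.single m a)) (fun a a' => by simp))
      (fun m m' => AddMonoidHom.ext fun a => by
        simp only [AddMonoidHom.mk'_apply, AddMonoidHom.add_apply, ← map_add]
        refine hq _ _ ⟨Finsupp.single (m + m') 1 - (Finsupp.single m 1 + Finsupp.single m' 1),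
          ?_, a, ?_⟩
        · rw [hK]; simp [hev]
        · ext x
          simp only [o, Finsupp.mapRange_apply, Finsupp.sub_apply, Finsupp.add_apply,
            Finsupp.single_apply, sub_smul, add_smul, ite_smul, one_smul, zero_smul])
  let s : BalancedTensor R M A →ₗ[ℤ] ((M →₀ A) ⧸ S) := balancedLift β (fun m r a => by
    refine hq _ _ ⟨Finsupp.single m r - Finsupp.single (MulOpposite.op r • m) 1, ?_, a, ?_⟩
    · rw [hK]; simp [hev]
    · ext x
      simp only [o, Finsupp.mapRange_apply, Finsupp.sub_apply,
        Finsupp.single_apply, sub_smul, ite_smul, one_smul, zero_smul])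
  have hs : q w = 0 := by
    have h := congrArg s hw
    rw [map_zero, Finsupp.sum, map_sum] at h
    rw [← h]
    conv_lhs => rw [← Finsupp.sum_single w, Finsupp.sum, map_sum]
    exact Finset.sum_congr rfl fun m _ => rfl
  obtain ⟨n, c, g, hg⟩ := Submodule.mem_span_set'.1 ((Submodule.Quotient.mk_eq_zero _).1 hs)
  choose ρ hρ b hb using fun j => (g j).2
  refine ⟨n, ρ, fun j => c j • b j, hρ, fun m => ?_⟩
  rw [← hg, Finsupp.finsetSum_apply]
  refine Finset.sum_congr rfl fun j _ => ?_
  rw [Finsupp.smul_apply, hb j]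
  exact smul_comm _ _ _

end BalancedTensor

/-! ### Exactness modulo finite matrices. -/

section TupleExact

variable {R : Type u} [Ring R]
  {A B C : Type*} [AddCommGroup A] [Module R A] [AddCommGroup B] [Module R B]
  [AddCommGroup C] [Module R C]

/-- Exactness of `A → B → C` at `B` modulo every finite matrix over `R`, i.e. exactness after
tensoring with every finitely presented right module. -/
def TupleExact (f : A →ₗ[R] B) (g : B →ₗ[R] C) : Prop :=
  ∀ ⦃q p : ℕ⦄ (r : Fin q → Fin p → R) (b : Fin q → B) (w : Fin p → C),
    (∀ l, g (b l) = ∑ i, r l i • w i) →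
      ∃ (e : Fin q → A) (v : Fin p → B), ∀ l, b l = f (e l) + ∑ i, r l i • v i

theorem TupleExact.exact_of_fintype {f : A →ₗ[R] B} {g : B →ₗ[R] C} (h : TupleExact f g)
    {ι : Type*} [Fintype ι] {p : ℕ} (r : ι → Fin p → R) (b : ι → B) (w : Fin p → C)
    (hb : ∀ l, g (b l) = ∑ i, r l i • w i) :
    ∃ (e : ι → A) (v : Fin p → B), ∀ l, b l = f (e l) + ∑ i, r l i • v i := by
  let φ := Fintype.equivFin ι
  obtain ⟨e, v, hv⟩ := h (fun l => r (φ.symm l)) (fun l => b (φ.symm l)) w (fun l => hb _)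
  exact ⟨fun l => e (φ l), v, fun l => by simpa using hv (φ l)⟩

theorem TupleExact.exact {f : A →ₗ[R] B} {g : B →ₗ[R] C} (h : TupleExact f g) (b : B)
    (hb : g b = 0) : ∃ a, f a = b := by
  obtain ⟨e, v, hv⟩ := h (q := 1) (p := 0) (fun _ => Fin.elim0) (fun _ => b) Fin.elim0 (by simpa)
  exact ⟨e 0, by simpa using (hv 0).symm⟩

/-- Vanishing in `M ⊗_R C` is witnessed by finitely many relations, which form a matrix. Modulo this
matrix the coefficients of `t` come from `A`, and the matrix part disappears when paired with the
elements of `M` satisfying the relations. -/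
theorem TupleExact.tensor {f : A →ₗ[R] B} {g : B →ₗ[R] C} (h : TupleExact f g)
    {M : Type*} [AddCommGroup M] [Module Rᵐᵒᵖ M] (t : BalancedTensor R M B)
    (ht : balancedMap M g t = 0) : ∃ s, balancedMap M f s = t := by
  classical
  obtain ⟨w, rfl⟩ := exists_eq_finsupp_sum t
  obtain ⟨n, ρ, c, hρ, hc⟩ := exists_relations_of_sum_eq_zero (w.mapRange g (map_zero _)) (by
    rw [Finsupp.sum_mapRange_index (by simp [pureTensor_zero_right]), ← ht, Finsupp.sum,
      Finsupp.sum, map_sum]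
    rfl)
  -- The rows of the matrix: the elements of `M` occurring in `w` or in some relation.
  let S : Finset M := w.support ∪ Finset.univ.biUnion fun j => (ρ j).support
  obtain ⟨e, v, hv⟩ := h.exact_of_fintype (ι := S) (fun m j => ρ j m) (fun m => w m) c
    (fun m => by simpa using hc m)
  refine ⟨∑ m : S, pureTensor (m : M) (e m), ?_⟩
  have h1 : (w.sum fun m a => pureTensor (R := R) m a) = ∑ m : S, pureTensor (m : M) (w m) := by
    rw [Finset.sum_coe_sort S (fun m => pureTensor (R := R) m (w m))]
    exact Finsupp.sum_of_support_subset _ Finset.subset_union_left _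
      (by simp [pureTensor_zero_right])
  have h2 : ∀ j, ∑ m : S, MulOpposite.op (ρ j m) • (m : M) = 0 := fun j => by
    rw [Finset.sum_coe_sort S (fun m => MulOpposite.op (ρ j m) • m), ← hρ j]
    refine (Finsupp.sum_of_support_subset _ (fun x hx => ?_)
      (fun m r => MulOpposite.op r • m) (by simp)).symm
    exact Finset.mem_union_right _ (Finset.mem_biUnion.2 ⟨j, Finset.mem_univ _, hx⟩)
  have h3 : ∑ m : S, pureTensor (R := R) (m : M) (∑ j, ρ j m • v j) = 0 := by
    simp only [pureTensor_sum_right, pureTensor_smul]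
    rw [Finset.sum_comm]
    refine Finset.sum_eq_zero fun j _ => ?_
    rw [← pureTensor_sum_left, h2, pureTensor_zero_left]
  rw [h1, map_sum]
  simp only [balancedMap_pureTensor]
  rw [← add_zero (∑ m : S, _), ← h3, ← Finset.sum_add_distrib]
  refine Finset.sum_congr rfl fun m _ => ?_
  rw [hv m, pureTensor_add_right]

/-- Exactness on tuples annihilated by a matrix, i.e. exactness of `Hom(F, -)` for finitely
presented `F`, implies exactness modulo every matrix. -/
theorem TupleExact.of_annihilated {D : Type*} [AddCommGroup D] [Module R D]
    {f : A →ₗ[R] B} {g : B →ₗ[R] C} {k : C →ₗ[R] D} (hkg : k ∘ₗ g = 0)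
    (hB : ∀ b, g b = 0 → ∃ a, f a = b)
    (hC : ∀ ⦃q p : ℕ⦄ (r : Fin q → Fin p → R) (c : Fin p → C), (∀ i, k (c i) = 0) →
      (∀ l, ∑ i, r l i • c i = 0) → ∃ b : Fin p → B, (∀ i, g (b i) = c i) ∧
        ∀ l, ∑ i, r l i • b i = 0)
    (hD : ∀ ⦃q p : ℕ⦄ (r : Fin q → Fin p → R) (d : Fin p → D), (∀ i, d i ∈ LinearMap.range k) →
      (∀ l, ∑ i, r l i • d i = 0) → ∃ c : Fin p → C, (∀ i, k (c i) = d i) ∧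
        ∀ l, ∑ i, r l i • c i = 0) :
    TupleExact f g := by
  intro q p r b w hbw
  -- Subtracting `c` turns `w` into a cycle without changing its product with the matrix.
  obtain ⟨c, hc, hc'⟩ := hD r (fun i => k (w i)) (fun i => ⟨_, rfl⟩) (fun l => by
    simp_rw [← map_smul, ← map_sum, ← hbw l]
    exact LinearMap.congr_fun hkg _)
  -- Only ordinary exactness at `C` is needed, hence a matrix without rows.
  obtain ⟨v, hv, -⟩ := hC (q := 0) Fin.elim0 (fun i => w i - c i) (by simp [hc]) (by simp)
  have : ∀ l, ∃ e, f e = b l - ∑ i, r l i • v i := fun l => hB _ (by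
    simp [hv, smul_sub, Finset.sum_sub_distrib, hc', hbw l])
  choose e he using this
  exact ⟨e, v, fun l => by rw [he]; abel⟩

end TupleExact

/-! ### From exactness modulo matrices to pure exact complexes. -/

section PureExact

variable {R : Type u} [Ring R]

theorem isPureShortExact_of_tensor_injective {A B C : Type v} [AddCommGroup A] [Module R A]
    [AddCommGroup B] [Module R B] [AddCommGroup C] [Module R C]
    {f : A →ₗ[R] B} {g : B →ₗ[R] C} (hf : Function.Injective f) (hfg : Function.Exact f g)
    (hg : Function.Surjective g)
    (h : ∀ (M : Type (max u v)) [AddCommGroup M] [Module Rᵐᵒᵖ M],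
      Function.Injective (balancedMap M f)) :
    IsPureShortExact f g where
  injective := hf
  exact := hfg
  surjective := hg
  tensor M _ _ := ⟨h M, balancedMap_exact M hfg hg, balancedMap_surjective M hg⟩

/-- A lift to `M ⊗_R B` of an element that dies in `M ⊗_R C` comes from `M ⊗_R A`, so the element
itself is zero because `g ∘ f = 0`. -/
theorem TupleExact.tensor_injective_range {A B C : Type*} [AddCommGroup A] [Module R A]
    [AddCommGroup B] [Module R B] [AddCommGroup C] [Module R C]
    {f : A →ₗ[R] B} {g : B →ₗ[R] C} (h : TupleExact f g) (hfg : g ∘ₗ f = 0)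
    (M : Type*) [AddCommGroup M] [Module Rᵐᵒᵖ M] :
    Function.Injective (balancedMap M (LinearMap.range g).subtype) := by
  rw [injective_iff_map_eq_zero]
  intro t ht
  obtain ⟨s, rfl⟩ := balancedMap_surjective M g.surjective_rangeRestrict t
  rw [balancedMap_comp, LinearMap.subtype_comp_codRestrict] at ht
  obtain ⟨s, rfl⟩ := h.tensor s ht
  rw [balancedMap_comp]
  convert balancedMap_zero s
  ext a
  exact LinearMap.congr_fun hfg a

/-- Cycles are boundaries, so every monomorphism involved is the inclusion of the range of a
differential. Right exactness of the tensor product then leaves only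
`TupleExact.tensor_injective_range` to apply. -/
theorem isPureExact_of_tupleExact (X : CochainComplex (ModuleCat.{v} R) ℤ)
    (h : ∀ i : ℤ, TupleExact (X.d i (i + 1)).hom (X.d (i + 1) (i + 1 + 1)).hom) :
    IsPureExact X := by
  have h' : ∀ i j k : ℤ, i + 1 = j → j + 1 = k → TupleExact (X.d i j).hom (X.d j k).hom := by
    rintro i j k rfl rfl
    exact h i
  have hdd : ∀ i j k : ℤ, (X.d j k).hom ∘ₗ (X.d i j).hom = 0 := fun i j k => by
    rw [← ModuleCat.hom_comp, X.d_comp_d, ModuleCat.hom_zero]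
  have hker : ∀ i j k : ℤ, i + 1 = j → j + 1 = k →
      LinearMap.ker (X.d j k).hom = LinearMap.range (X.d i j).hom := fun i j k hij hjk => by
    refine le_antisymm (fun x hx => (h' i j k hij hjk).exact x hx) ?_
    rintro _ ⟨y, rfl⟩
    exact LinearMap.congr_fun (hdd i j k) y
  have hrange : ∀ i j k : ℤ, i + 1 = j → j + 1 = k →
      ∀ (M : Type (max u v)) [AddCommGroup M] [Module Rᵐᵒᵖ M],
      Function.Injective (balancedMap M (LinearMap.range (X.d j k).hom).subtype) :=
    fun i j k hij hjk M _ _ => (h' i j k hij hjk).tensor_injective_range (hdd i j k) M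
  have hdec : ∀ j k : ℤ, j + 1 = k → IsPureDecomposable (X.d j k) := fun j k hjk => by
    refine ⟨ModuleCat.of R (LinearMap.range (X.d j k).hom),
      ModuleCat.ofHom (X.d j k).hom.rangeRestrict,
      ModuleCat.ofHom (LinearMap.range (X.d j k).hom).subtype, ?_, ?_, ?_⟩
    · refine ⟨ModuleCat.of R (LinearMap.ker (X.d j k).hom),
        ModuleCat.ofHom (LinearMap.ker (X.d j k).hom).subtype,
        isPureShortExact_of_tensor_injective (Submodule.subtype_injective _) ?_
          (X.d j k).hom.surjective_rangeRestrict ?_⟩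
      · rw [LinearMap.exact_iff]
        simp
      · simp only [ModuleCat.hom_ofHom]
        rw [hker (j - 1) j k (by lia) hjk]
        exact hrange (j - 1 - 1) (j - 1) j (by lia) (by lia)
    · refine ⟨ModuleCat.of R (X.X k ⧸ LinearMap.range (X.d j k).hom),
        ModuleCat.ofHom (LinearMap.range (X.d j k).hom).mkQ,
        isPureShortExact_of_tensor_injective (Submodule.subtype_injective _) ?_
          (Submodule.mkQ_surjective _) (hrange (j - 1) j k (by lia) hjk)⟩
      rw [LinearMap.exact_iff]
      simp
    · ext x
      rfl
  intro n
  refine ⟨hdec _ _ (by lia), hdec _ _ rfl,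
    isPureShortExact_of_tensor_injective (Submodule.subtype_injective _) ?_
      (Submodule.mkQ_surjective _) ?_⟩
  · rw [LinearMap.exact_iff, Submodule.ker_mkQ, Submodule.range_subtype,
      hker (n - 1) n (n + 1) (by lia) rfl]
  · rw [hker (n - 1) n (n + 1) (by lia) rfl]
    exact hrange (n - 1 - 1) (n - 1) n (by lia) (by lia)

theorem IsPureExactAt.exact {X : CochainComplex (ModuleCat.{v} R) ℤ} {j : ℤ}
    (h : IsPureExactAt X j) {i k : ℤ} (hij : i + 1 = j) (hjk : j + 1 = k) :
    LinearMap.ker (X.d j k).hom = LinearMap.range (X.d i j).hom := by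
  obtain rfl : i = j - 1 := by lia
  subst hjk
  have := h.ses.exact
  rwa [LinearMap.exact_iff, Submodule.ker_mkQ, Submodule.range_subtype, eq_comm] at this

theorem IsPureExactAt.isPureMono_ker {X : CochainComplex (ModuleCat.{v} R) ℤ} {j : ℤ}
    (h : IsPureExactAt X j) {k : ℤ} (hjk : j + 1 = k) :
    IsPureMono (ModuleCat.ofHom (LinearMap.ker (X.d j k).hom).subtype) := by
  subst hjk
  exact ⟨ModuleCat.of R _, ModuleCat.ofHom _, h.ses⟩

end PureExact

/-! ### Character modules and the double dual. -/

section Dual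

variable {R : Type u} [Ring R]

/-- The characters of a left `R`-module, a right `R`-module. -/
def RightDual (A : Type*) [AddCommGroup A] := A →+ AddCircle (1 : ℚ)

/-- The characters of a right `R`-module, a left `R`-module. -/
def LeftDual (M : Type*) [AddCommGroup M] := M →+ AddCircle (1 : ℚ)

instance (A : Type*) [AddCommGroup A] : AddCommGroup (RightDual A) :=
  inferInstanceAs (AddCommGroup (A →+ AddCircle (1 : ℚ)))

instance (A : Type*) [AddCommGroup A] : AddCommGroup (LeftDual A) :=
  inferInstanceAs (AddCommGroup (A →+ AddCircle (1 : ℚ)))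

instance (A : Type*) [AddCommGroup A] : FunLike (RightDual A) A (AddCircle (1 : ℚ)) :=
  inferInstanceAs (FunLike (A →+ AddCircle (1 : ℚ)) _ _)

instance (A : Type*) [AddCommGroup A] : FunLike (LeftDual A) A (AddCircle (1 : ℚ)) :=
  inferInstanceAs (FunLike (A →+ AddCircle (1 : ℚ)) _ _)

instance (A : Type*) [AddCommGroup A] :
    AddMonoidHomClass (RightDual A) A (AddCircle (1 : ℚ)) :=
  inferInstanceAs (AddMonoidHomClass (A →+ AddCircle (1 : ℚ)) _ _)

instance (A : Type*) [AddCommGroup A] :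
    AddMonoidHomClass (LeftDual A) A (AddCircle (1 : ℚ)) :=
  inferInstanceAs (AddMonoidHomClass (A →+ AddCircle (1 : ℚ)) _ _)

instance (A : Type*) [AddCommGroup A] [Module R A] : Module Rᵐᵒᵖ (RightDual A) where
  smul r χ := AddMonoidHom.comp χ (DistribSMul.toAddMonoidHom A r.unop)
  one_smul χ := DFunLike.ext _ _ fun a => congrArg χ (one_smul R a)
  mul_smul r s χ := DFunLike.ext _ _ fun a => congrArg χ (mul_smul s.unop r.unop a)
  smul_zero _ := rfl
  smul_add _ _ _ := rfl
  add_smul r s χ := DFunLike.ext _ _ fun a =>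
    (congrArg χ (add_smul r.unop s.unop a)).trans (map_add χ _ _)
  zero_smul χ := DFunLike.ext _ _ fun a => (congrArg χ (zero_smul R a)).trans (map_zero χ)

instance (M : Type*) [AddCommGroup M] [Module Rᵐᵒᵖ M] : Module R (LeftDual M) where
  smul r χ := AddMonoidHom.comp χ (DistribSMul.toAddMonoidHom M (MulOpposite.op r))
  one_smul χ := DFunLike.ext _ _ fun a => congrArg χ (one_smul Rᵐᵒᵖ a)
  mul_smul r s χ := DFunLike.ext _ _ fun a =>
    congrArg χ (mul_smul (MulOpposite.op s) (MulOpposite.op r) a)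
  smul_zero _ := rfl
  smul_add _ _ _ := rfl
  add_smul r s χ := DFunLike.ext _ _ fun a =>
    (congrArg χ (add_smul (MulOpposite.op r) (MulOpposite.op s) a)).trans (map_add χ _ _)
  zero_smul χ := DFunLike.ext _ _ fun a => (congrArg χ (zero_smul Rᵐᵒᵖ a)).trans (map_zero χ)

theorem RightDual.smul_apply {A : Type*} [AddCommGroup A] [Module R A] (r : Rᵐᵒᵖ)
    (χ : RightDual A) (a : A) : (r • χ) a = χ (r.unop • a) := rfl

theorem LeftDual.smul_apply {M : Type*} [AddCommGroup M] [Module Rᵐᵒᵖ M] (r : R)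
    (χ : LeftDual M) (m : M) : (r • χ) m = χ (MulOpposite.op r • m) := rfl

theorem RightDual.sum_apply {A : Type*} [AddCommGroup A] {ι : Type*} (s : Finset ι)
    (χ : ι → RightDual A) (a : A) : (∑ i ∈ s, χ i) a = ∑ i ∈ s, χ i a :=
  AddMonoidHom.finsetSum_apply χ s a

theorem LeftDual.sum_apply {M : Type*} [AddCommGroup M] {ι : Type*} (s : Finset ι)
    (χ : ι → LeftDual M) (m : M) : (∑ i ∈ s, χ i) m = ∑ i ∈ s, χ i m :=
  AddMonoidHom.finsetSum_apply χ s m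

theorem LeftDual.zsmul_apply {M : Type*} [AddCommGroup M] (n : ℤ) (χ : LeftDual M) (m : M) :
    (n • χ) m = χ (n • m) :=
  (map_zsmul χ n m).symm

variable (R) in
/-- The canonical map to the double character module. -/
def toDoubleDual (A : Type*) [AddCommGroup A] [Module R A] :
    A →ₗ[R] LeftDual (RightDual A) where
  toFun a := AddMonoidHom.mk' (fun χ : RightDual A => χ a) (fun _ _ => rfl)
  map_add' a b := DFunLike.ext _ _ fun χ : RightDual A => map_add χ a b
  map_smul' _ _ := rfl

theorem toDoubleDual_apply {A : Type*} [AddCommGroup A] [Module R A] (a : A)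
    (χ : RightDual A) : toDoubleDual R A a χ = χ a := rfl

/-- Purity of the canonical map to the double character module. -/
theorem toDoubleDual_pure {A : Type*} [AddCommGroup A] [Module R A] {q p : ℕ}
    (r : Fin q → Fin p → R) (a : Fin q → A) (w : Fin p → LeftDual (RightDual A))
    (h : ∀ l, toDoubleDual R A (a l) = ∑ i, r l i • w i) :
    ∃ v : Fin p → A, ∀ l, a l = ∑ i, r l i • v i := by
  classical
  let θ : (Fin p → A) →+ (Fin q → A) := AddMonoidHom.mk' (fun v l => ∑ i, r l i • v i)
    (fun v v' => by ext l; simp [Finset.sum_add_distrib])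
  -- Otherwise a character of `A^q` kills the image of the matrix but not `a`. Its coordinates
  -- satisfy the transposed relations, so pairing them with `w` gives a contradiction.
  by_contra hcon
  have ha : (QuotientAddGroup.mk a : (Fin q → A) ⧸ θ.range) ≠ 0 := by
    rw [Ne, QuotientAddGroup.eq_zero_iff]
    rintro ⟨v, hv⟩
    exact hcon ⟨v, fun l => (congrFun hv l).symm⟩
  obtain ⟨χ, hχ⟩ := CharacterModule.exists_character_apply_ne_zero_of_ne_zero ha
  let ξ : (Fin q → A) →+ AddCircle (1 : ℚ) :=
    AddMonoidHom.comp χ (QuotientAddGroup.mk' θ.range)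
  have hξθ : ∀ v, ξ (θ v) = 0 := fun v => by
    have : (QuotientAddGroup.mk (θ v) : (Fin q → A) ⧸ θ.range) = 0 :=
      (QuotientAddGroup.eq_zero_iff _).2 ⟨v, rfl⟩
    exact (congrArg χ this).trans (map_zero χ)
  let c : Fin q → RightDual A := fun l => AddMonoidHom.comp ξ (AddMonoidHom.single (fun _ => A) l)
  have hsum : ∀ x : Fin q → A, ξ x = ∑ l, c l (x l) := fun x => by
    conv_lhs => rw [← Finset.univ_sum_single x, map_sum]
    rfl
  have hc : ∀ i, ∑ l, MulOpposite.op (r l i) • c l = 0 := fun i =>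
    DFunLike.ext _ _ fun v => by
      rw [RightDual.sum_apply]
      have h2 := hξθ (Pi.single i v)
      rw [hsum] at h2
      refine Eq.trans (Finset.sum_congr rfl fun l _ => ?_) h2
      rw [RightDual.smul_apply, MulOpposite.unop_op]
      congr 1
      change r l i • v = ∑ j, r l j • (Pi.single i v : Fin p → A) j
      rw [Finset.sum_eq_single i (fun j _ hj => by simp [hj]) (by simp)]
      simp
  apply hχ
  calc ξ a = ∑ l, c l (a l) := hsum a
    _ = ∑ l, ∑ i, w i (MulOpposite.op (r l i) • c l) :=
        Finset.sum_congr rfl fun l _ => by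
          rw [← toDoubleDual_apply (R := R), h l, LeftDual.sum_apply]
          rfl
    _ = ∑ i, w i (∑ l, MulOpposite.op (r l i) • c l) := by
        rw [Finset.sum_comm]
        exact Finset.sum_congr rfl fun i _ => (map_sum _ _ _).symm
    _ = 0 := Finset.sum_eq_zero fun i _ => by rw [hc, map_zero]

end Dual

/-! ### Pure injectivity of character modules, with integer relations. -/

section PureInjective

variable {R : Type u} [Ring R]

/-- The submodules of `J ^ p` cut out by integer matrices are pure injective. -/
def IsTuplePureInjective (J : ModuleCat.{v} R) : Prop :=
  ∀ ⦃q p : ℕ⦄ (r : Fin q → Fin p → ℤ) ⦃A B : ModuleCat.{v} R⦄ (f : A ⟶ B), IsPureMono f →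
    ∀ φ : Fin p → (A ⟶ J), (∀ l, ∑ i, r l i • φ i = 0) →
      ∃ ψ : Fin p → (B ⟶ J), (∀ i, f ≫ ψ i = φ i) ∧ ∀ l, ∑ i, r l i • ψ i = 0

theorem IsTuplePureInjective.isPureInjective {J : ModuleCat.{v} R}
    (hJ : IsTuplePureInjective J) : IsPureInjective J := by
  intro A B f hf h
  obtain ⟨ψ, hψ, -⟩ := hJ (q := 0) (p := 1) Fin.elim0 f hf (fun _ => h) (fun l => l.elim0)
  exact ⟨ψ 0, hψ 0⟩

theorem isPureInjective_pi (J : ℕ → ModuleCat.{v} R)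
    (hJ : ∀ i, IsPureInjective (J i)) : IsPureInjective (ModuleCat.of R (∀ i, J i)) := by
  intro A B f hf h
  choose k hk using fun i => hJ i f hf (h ≫ ModuleCat.ofHom (LinearMap.proj i))
  refine ⟨ModuleCat.ofHom (LinearMap.pi fun i => (k i).hom), ?_⟩
  ext x i
  exact LinearMap.congr_fun (congrArg ModuleCat.Hom.hom (hk i)) x

/-- Tuples of characters of `P` subject to the relations are characters of `P^p / N`. By adjunction
the tuple `φ` becomes one character of `(P^p / N) ⊗_R A`. -/
theorem isTuplePureInjective_leftDual (P : Type u) [AddCommGroup P] [Module Rᵐᵒᵖ P] :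
    IsTuplePureInjective (ModuleCat.of R (LeftDual P)) := by
  classical
  intro q p r A B f hf φ hφ
  let N : Submodule Rᵐᵒᵖ (Fin p → P) :=
    Submodule.span Rᵐᵒᵖ {y | ∃ (l : Fin q) (x : P), y = fun i => r l i • x}
  let β : (Fin p → P) →ₗ[Rᵐᵒᵖ] RightDual A :=
    { toFun := fun x => AddMonoidHom.mk' (fun a => ∑ i, (φ i a : LeftDual P) (x i)) (fun a a' => by
        rw [← Finset.sum_add_distrib]
        exact Finset.sum_congr rfl fun i _ => by rw [map_add]; rfl)
      map_add' := fun x y => DFunLike.ext _ _ fun a => by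
        change ∑ i, (φ i a : LeftDual P) (x i + y i) =
          ∑ i, (φ i a : LeftDual P) (x i) + ∑ i, (φ i a : LeftDual P) (y i)
        simp only [map_add, Finset.sum_add_distrib]
      map_smul' := fun s x => DFunLike.ext _ _ fun a => by
        change ∑ i, (φ i a : LeftDual P) (s • x i) =
          ∑ i, (φ i (s.unop • a) : LeftDual P) (x i)
        exact Finset.sum_congr rfl fun i _ => by
          rw [map_smul (φ i).hom]; rfl }
  have hN : N ≤ LinearMap.ker β := by
    refine Submodule.span_le.2 ?_
    rintro _ ⟨l, x, rfl⟩
    refine DFunLike.ext _ _ fun a => ?_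
    have h := congrArg (fun g : A ⟶ ModuleCat.of R (LeftDual P) => (g.hom a : LeftDual P) x) (hφ l)
    simp only [ModuleCat.hom_sum, LinearMap.sum_apply] at h
    rw [LeftDual.sum_apply] at h
    change ∑ i, (φ i a : LeftDual P) (r l i • x) = 0
    exact Eq.trans (Finset.sum_congr rfl fun i _ => (LeftDual.zsmul_apply _ _ _).symm) h
  let βbar := N.liftQ β hN
  let Φ := balancedLift (A := A) (AddMonoidHomClass.toAddMonoidHom βbar : _ →+ A →+ _)
    (fun m s a => (DFunLike.congr_fun (βbar.map_smul (MulOpposite.op s) m) a).symm)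
  obtain ⟨C, g, hfg⟩ := hf
  -- Purity keeps `f` injective after tensoring, and `ℚ/ℤ` is injective, so the character extends.
  obtain ⟨Ψ, hΨ⟩ := CharacterModule.dual_surjective_of_injective _
    (hfg.tensor ((Fin p → P) ⧸ N)).1 Φ.toAddMonoidHom
  let T : Fin p → P →+ B →+ AddCircle (1 : ℚ) := fun i =>
    AddMonoidHom.mk' (fun x => AddMonoidHom.comp Ψ
      (pureTensorHom R ((Fin p → P) ⧸ N) B (Submodule.Quotient.mk (Pi.single i x))))
      (fun x y => by
        rw [Pi.single_add, Submodule.Quotient.mk_add, map_add]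
        exact AddMonoidHom.ext fun b => map_add Ψ _ _)
  let ψ : Fin p → (B →ₗ[R] LeftDual P) := fun i =>
    { toFun := fun b => (T i).flip b
      map_add' := fun b b' => map_add (T i).flip b b'
      map_smul' := fun s b => DFunLike.ext _ _ fun x => by
        change Ψ (pureTensor _ (s • b)) = Ψ (pureTensor _ b)
        rw [pureTensor_smul, ← Submodule.Quotient.mk_smul, ← Pi.single_smul]
        rfl }
  refine ⟨fun i => ModuleCat.ofHom (ψ i), fun i => ?_, fun l => ?_⟩
  · ext a
    refine DFunLike.ext _ _ fun x => ?_
    have h := DFunLike.congr_fun hΨ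
      (pureTensor (Submodule.Quotient.mk (Pi.single i x) : (Fin p → P) ⧸ N) a)
    change Ψ (pureTensor _ (f a)) = (φ i a : LeftDual P) x
    refine h.trans ?_
    change ∑ j, (φ j a : LeftDual P) ((Pi.single i x : Fin p → P) j) = _
    rw [Finset.sum_eq_single i (fun j _ hj => by rw [Pi.single_eq_of_ne hj, map_zero])
      (by simp), Pi.single_eq_same]
  · ext b
    refine DFunLike.ext _ _ fun x => ?_
    simp only [ModuleCat.hom_sum, LinearMap.sum_apply]
    rw [LeftDual.sum_apply]
    have h0 : (Submodule.Quotient.mk (fun i => r l i • x) : (Fin p → P) ⧸ N) = 0 :=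
      (Submodule.Quotient.mk_eq_zero _).2 (Submodule.subset_span ⟨l, x, rfl⟩)
    have h1 : (fun i => r l i • x) = ∑ i, (Pi.single i (r l i • x) : Fin p → P) :=
      (Finset.univ_sum_single _).symm
    have h2 : ∑ i, (Submodule.Quotient.mk (Pi.single i (r l i • x)) : (Fin p → P) ⧸ N) = 0 := by
      rw [← h0, h1]
      exact (map_sum N.mkQ _ _).symm
    calc _ = ∑ i, Ψ (pureTensor (Submodule.Quotient.mk (Pi.single i (r l i • x))) b) :=
          Finset.sum_congr rfl fun i _ => LeftDual.zsmul_apply (r l i) (ψ i b) x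
      _ = 0 := by
          rw [← map_sum, ← pureTensor_sum_left, h2, pureTensor_zero_left, map_zero]

end PureInjective

/-! ### Successive approximation. -/

section Approximation

/-- Successive approximation with respect to a complete sequence of relations. -/
theorem exists_forall_of_approximations {Ψ : Type*} (agree : ℕ → Ψ → Ψ → Prop)
    (S : ℕ → Ψ → Prop) (h0 : ∃ y, S 0 y)
    (step : ∀ l y, S l y → ∃ y', S (l + 1) y' ∧ agree l y y')
    (complete : ∀ s : ℕ → Ψ, (∀ l, agree l (s l) (s (l + 1))) → ∃ y, ∀ l, agree l (s l) y)
    (cont : ∀ l y y', agree l y y' → S l y → S l y') : ∃ y, ∀ l, S l y := by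
  choose! g hg using step
  obtain ⟨y0, hy0⟩ := h0
  let s : ℕ → Ψ := fun l => Nat.rec y0 (fun l y => g l y) l
  have hs : ∀ l, S l (s l) := fun l => by
    induction l with
    | zero => exact hy0
    | succ l ih => exact (hg l (s l) ih).1
  obtain ⟨y, hy⟩ := complete s fun l => (hg l (s l) (hs l)).2
  exact ⟨y, fun l => cont l (s l) y (hy l) (hs l)⟩

end Approximation

/-! ### The ghost tower and the exactness of its limit. -/

section Tower

variable {R : Type u} [Ring R]

/-- The double character module of the cokernel of the differential into degree `m - 1`. -/
def ghostTarget (C : CochainComplex (ModuleCat.{u} R) ℤ) (m : ℤ) : ModuleCat.{u} R :=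
  ModuleCat.of R
    (LeftDual (RightDual (C.X (m - 1) ⧸ LinearMap.range (C.d (m - 2) (m - 1)).hom)))

/-- A degree one map to a graded module of pure injectives which vanishes on boundaries and is
purely injective modulo boundaries. -/
noncomputable def ghostMap (C : CochainComplex (ModuleCat.{u} R) ℤ) (n m : ℤ) (h : n + 1 = m) :
    C.X n ⟶ ghostTarget C m :=
  (C.XIsoOfEq (show n = m - 1 by lia)).hom ≫
    ModuleCat.ofHom (toDoubleDual R _ ∘ₗ Submodule.mkQ (LinearMap.range (C.d (m - 2) (m - 1)).hom))

theorem isTuplePureInjective_ghostTarget (C : CochainComplex (ModuleCat.{u} R) ℤ) (m : ℤ) :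
    IsTuplePureInjective (ghostTarget C m) :=
  isTuplePureInjective_leftDual _

theorem ghostMap_pred (C : CochainComplex (ModuleCat.{u} R) ℤ) (m : ℤ) (h : m - 1 + 1 = m)
    (x : C.X (m - 1)) :
    (ghostMap C (m - 1) m h).hom x = toDoubleDual R _ (Submodule.Quotient.mk x) := by
  rw [ghostMap, HomologicalComplex.XIsoOfEq_rfl]
  rfl

theorem ghostMap_d (C : CochainComplex (ModuleCat.{u} R) ℤ) {i j k : ℤ} (hij : i + 1 = j)
    (hjk : j + 1 = k) (x : C.X i) :
    (ghostMap C j k hjk).hom ((C.d i j).hom x) = 0 := by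
  obtain rfl : j = k - 1 := by lia
  obtain rfl : i = k - 2 := by lia
  rw [ghostMap_pred, (Submodule.Quotient.mk_eq_zero
    (LinearMap.range (C.d (k - 2) (k - 1)).hom)).2 ⟨x, rfl⟩, map_zero]
  rfl

/-- Purity of the double dual embedding descends divisibility by the matrix to `C^j / B^j`; lifting
to `C^j` costs a boundary. -/
theorem tupleExact_ghostMap (C : CochainComplex (ModuleCat.{u} R) ℤ) {i j k : ℤ}
    (hij : i + 1 = j) (hjk : j + 1 = k) :
    TupleExact (C.d i j).hom (ghostMap C j k hjk).hom := by
  obtain rfl : j = k - 1 := by lia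
  obtain rfl : i = k - 2 := by lia
  intro q p r b w hb
  simp only [ghostMap_pred] at hb
  obtain ⟨v, hv⟩ := toDoubleDual_pure r _ w hb
  choose v' hv' using fun i => Submodule.Quotient.mk_surjective _ (v i)
  have : ∀ l, ∃ e, (C.d (k - 2) (k - 1)).hom e = b l - ∑ i, r l i • v' i := fun l => by
    refine LinearMap.mem_range.1 ((Submodule.Quotient.mk_eq_zero _).1 ?_)
    rw [Submodule.Quotient.mk_sub, hv l, sub_eq_zero]
    simp only [← hv', ← Submodule.mkQ_apply, map_sum, map_smul]
  choose e he using this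
  exact ⟨e, v', fun l => by rw [he]; abel⟩

/-- The differential of the shifted mapping cone of the ghost map. -/
noncomputable def ghostFiberD (C : CochainComplex (ModuleCat.{u} R) ℤ) (n : ℤ) :
    ModuleCat.of R (C.X n × ghostTarget C n) ⟶
      ModuleCat.of R (C.X (n + 1) × ghostTarget C (n + 1)) :=
  ModuleCat.ofHom (((C.d n (n + 1)).hom.prod (ghostMap C n (n + 1) rfl).hom) ∘ₗ
    LinearMap.fst R (C.X n) (ghostTarget C n))

/-- The shifted mapping cone of the ghost map. -/
noncomputable def ghostFiber (C : CochainComplex (ModuleCat.{u} R) ℤ) :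
    CochainComplex (ModuleCat.{u} R) ℤ :=
  CochainComplex.of (fun n => ModuleCat.of R (C.X n × ghostTarget C n))
    (ghostFiberD C) (fun n => by
      refine ModuleCat.hom_ext (LinearMap.ext fun x => Prod.ext ?_ ?_)
      · exact LinearMap.congr_fun (congrArg ModuleCat.Hom.hom (C.d_comp_d n _ _)) _
      · exact ghostMap_d C rfl rfl _)

theorem ghostFiber_d_apply (C : CochainComplex (ModuleCat.{u} R) ℤ) {i j : ℤ} (hij : i + 1 = j)
    (x : C.X i × ghostTarget C i) :
    ((ghostFiber C).d i j).hom x =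
      (((C.d i j).hom x.1, (ghostMap C i j hij).hom x.1) : C.X j × ghostTarget C j) := by
  subst hij
  have h := CochainComplex.of_d (fun n => ModuleCat.of R (C.X n × ghostTarget C n))
    (ghostFiberD C) i
  exact LinearMap.congr_fun (congrArg ModuleCat.Hom.hom h) x

variable (X : CochainComplex (ModuleCat.{u} R) ℤ)

/-- The tower of iterated fibers of ghost maps. -/
noncomputable def ghostTower : ℕ → CochainComplex (ModuleCat.{u} R) ℤ
  | 0 => X
  | l + 1 => ghostFiber (ghostTower l)

/-- The degree `n` part of the limit of the ghost tower. -/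
abbrev GhostLimit (n : ℤ) : Type u := X.X n × ∀ l, ghostTarget (ghostTower X l) n

/-- The projection of the limit to the stages of the ghost tower. -/
noncomputable def ghostTrunc : ∀ (l : ℕ) (n : ℤ), GhostLimit X n →ₗ[R] (ghostTower X l).X n
  | 0, n => LinearMap.fst R (X.X n) (∀ l, ghostTarget (ghostTower X l) n)
  | l + 1, n => (ghostTrunc l n).prod (LinearMap.proj (φ := fun l => ghostTarget (ghostTower X l) n)
      l ∘ₗ LinearMap.snd R (X.X n) (∀ l, ghostTarget (ghostTower X l) n))

variable {X}

theorem ghostTrunc_succ (l : ℕ) {n : ℤ} (y : GhostLimit X n) :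
    ghostTrunc X (l + 1) n y =
      ((ghostTrunc X l n y, y.2 l) : (ghostTower X l).X n × ghostTarget (ghostTower X l) n) := rfl

theorem ghostTrunc_succ_eq_iff {l : ℕ} {n : ℤ} {y y' : GhostLimit X n} :
    ghostTrunc X (l + 1) n y = ghostTrunc X (l + 1) n y' ↔
      ghostTrunc X l n y = ghostTrunc X l n y' ∧ y.2 l = y'.2 l :=
  Prod.ext_iff

theorem ghostTrunc_eq_of_forall_lt {l : ℕ} {n : ℤ} {y y' : GhostLimit X n} (h : y.1 = y'.1)
    (h' : ∀ j < l, y.2 j = y'.2 j) : ghostTrunc X l n y = ghostTrunc X l n y' := by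
  induction l with
  | zero => exact h
  | succ l ih =>
    exact ghostTrunc_succ_eq_iff.2 ⟨ih fun j hj => h' j (by lia), h' l (by lia)⟩

/-- Coordinate `l` is settled from stage `l + 1` on, so it is read off `s (l + 1)`. -/
theorem exists_ghostTrunc_eq {n : ℤ} (s : ℕ → GhostLimit X n)
    (hs : ∀ l, ghostTrunc X l n (s l) = ghostTrunc X l n (s (l + 1))) :
    ∃ y, ∀ l, ghostTrunc X l n (s l) = ghostTrunc X l n y := by
  refine ⟨((s 0).1, fun l => (s (l + 1)).2 l), fun l => ?_⟩
  induction l with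
  | zero => rfl
  | succ l ih => exact ghostTrunc_succ_eq_iff.2 ⟨by rw [← hs, ih], rfl⟩

theorem ghostTrunc_surjective (l : ℕ) (n : ℤ) : Function.Surjective (ghostTrunc X l n) := by
  classical
  induction l with
  | zero => exact fun x => ⟨(x, 0), rfl⟩
  | succ l ih =>
    intro (x : (ghostTower X l).X n × ghostTarget (ghostTower X l) n)
    obtain ⟨y, hy⟩ := ih x.1
    refine ⟨(y.1, Function.update y.2 l x.2), ?_⟩
    rw [ghostTrunc_succ]
    refine Prod.ext ?_ (Function.update_self _ _ _)
    rw [← hy]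
    exact ghostTrunc_eq_of_forall_lt rfl fun j hj => Function.update_of_ne hj.ne _ _

variable (X) in
/-- The differential on the limit of the ghost tower. -/
noncomputable def ghostD (i j : ℤ) (h : i + 1 = j) : GhostLimit X i →ₗ[R] GhostLimit X j :=
  ((X.d i j).hom ∘ₗ LinearMap.fst R (X.X i) (∀ l, ghostTarget (ghostTower X l) i)).prod
    (LinearMap.pi fun l => (ghostMap (ghostTower X l) i j h).hom ∘ₗ ghostTrunc X l i)

theorem ghostD_fst {i j : ℤ} (h : i + 1 = j) (y : GhostLimit X i) :
    (ghostD X i j h y).1 = (X.d i j).hom y.1 := rfl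

theorem ghostD_snd {i j : ℤ} (h : i + 1 = j) (y : GhostLimit X i) (l : ℕ) :
    (ghostD X i j h y).2 l = (ghostMap (ghostTower X l) i j h).hom (ghostTrunc X l i y) := rfl

theorem ghostTrunc_ghostD (l : ℕ) {i j : ℤ} (h : i + 1 = j) (y : GhostLimit X i) :
    ghostTrunc X l j (ghostD X i j h y) = ((ghostTower X l).d i j).hom (ghostTrunc X l i y) := by
  induction l with
  | zero => rfl
  | succ l ih =>
    rw [ghostTrunc_succ, ih, ghostD_snd]
    exact (ghostFiber_d_apply (ghostTower X l) h (ghostTrunc X (l + 1) i y)).symm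

theorem ghostD_ghostD {i j k : ℤ} (hij : i + 1 = j) (hjk : j + 1 = k) (y : GhostLimit X i) :
    ghostD X j k hjk (ghostD X i j hij y) = 0 := by
  refine Prod.ext ?_ (funext fun l => ?_)
  · exact LinearMap.congr_fun (congrArg ModuleCat.Hom.hom (X.d_comp_d i j k)) y.1
  · rw [ghostD_snd, ghostTrunc_ghostD]
    exact ghostMap_d _ hij hjk _

/-- The equations hold coordinatewise in a product, so the solutions at different stages need no
compatibility. -/
theorem exists_eq_sum_smul_of_ghostTrunc {n : ℤ} {q p : ℕ} (r : Fin q → Fin p → R)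
    (t : Fin q → GhostLimit X n)
    (h : ∀ l, ∃ v : Fin p → GhostLimit X n,
      ∀ j, ghostTrunc X l n (t j) = ghostTrunc X l n (∑ i, r j i • v i)) :
    ∃ v : Fin p → GhostLimit X n, ∀ j, t j = ∑ i, r j i • v i := by
  choose v hv using h
  refine ⟨fun i => ((v 0 i).1, fun l => (v (l + 1) i).2 l), fun j =>
    Prod.ext ?_ (funext fun l => ?_)⟩
  · refine (hv 0 j).trans ?_
    change (∑ i, r j i • v 0 i).1 = _
    simp [Prod.fst_sum]
  · refine (ghostTrunc_succ_eq_iff.1 (hv (l + 1) j)).2.trans ?_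
    simp [Prod.snd_sum]

/-- The limit of the ghost tower is exact modulo every matrix. -/
theorem tupleExact_ghostD {i j k : ℤ} (hij : i + 1 = j) (hjk : j + 1 = k) :
    TupleExact (ghostD X i j hij) (ghostD X j k hjk) := by
  intro q p r z w hz
  -- Stage `l + 1` of the differential of `y` depends only on stage `l` of `y`. Hence `S l` tests
  -- stage `l + 1` while agreement is measured at stage `l`.
  let S : ℕ → (Fin q → GhostLimit X i) → Prop := fun l y =>
    ∃ v : Fin p → GhostLimit X j, ∀ a, ghostTrunc X (l + 1) j (z a - ghostD X i j hij (y a)) =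
      ghostTrunc X (l + 1) j (∑ c, r a c • v c)
  have hS : ∀ l, ∃ y, S l y := fun l => by
    obtain ⟨e, v, hv⟩ := tupleExact_ghostMap (ghostTower X (l + 1)) hij hjk r
      (fun a => ghostTrunc X (l + 1) j (z a)) (fun c => (w c).2 (l + 1)) (fun a => by
        rw [← ghostD_snd, hz a]
        simp [Prod.snd_sum])
    choose e' he' using fun a => ghostTrunc_surjective (X := X) (l + 1) i (e a)
    choose v' hv' using fun c => ghostTrunc_surjective (X := X) (l + 1) j (v c)
    refine ⟨e', v', fun a => ?_⟩
    rw [map_sub, hv a, ghostTrunc_ghostD, he', map_sum, add_sub_cancel_left]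
    simp only [map_smul, hv']
  obtain ⟨y, hy⟩ : ∃ y, ∀ l, S l y := by
    refine exists_forall_of_approximations
      (fun l y y' => ∀ a, ghostTrunc X l i (y a) = ghostTrunc X l i (y' a)) S (hS 0) ?_ ?_ ?_
    · rintro l y ⟨v, hv⟩
      obtain ⟨y', v', hv'⟩ := hS (l + 1)
      -- Two solutions differ by a cycle modulo `r`, hence at stage `l` by a boundary modulo `r`.
      -- Adding lifts of `e` and `s` to `y'` restores agreement with `y`, and `v'` absorbs the
      -- change.
      obtain ⟨e, s, hs⟩ := tupleExact_ghostMap (ghostTower X l) (i := i - 1) (by lia) hij r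
        (fun a => ghostTrunc X l i (y a - y' a)) (fun c => (v' c - v c).2 l) (fun a => by
          have h1 := (ghostTrunc_succ_eq_iff.1 (hv a)).2
          have h2 := (ghostTrunc_succ_eq_iff.1 (ghostTrunc_succ_eq_iff.1 (hv' a)).1).2
          rw [← ghostD_snd]
          simp only [map_sub, Prod.snd_sub, Pi.sub_apply, Prod.snd_sum, Finset.sum_apply,
            Prod.smul_snd, Pi.smul_apply, smul_sub, Finset.sum_sub_distrib] at h1 h2 ⊢
          rw [← h1, ← h2]
          abel)
      choose e' he' using fun a => ghostTrunc_surjective (X := X) l (i - 1) (e a)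
      choose s' hs' using fun c => ghostTrunc_surjective (X := X) l i (s c)
      refine ⟨fun a => y' a + ghostD X (i - 1) i (by lia) (e' a) + ∑ c, r a c • s' c,
        ⟨fun c => v' c - ghostD X i j hij (s' c), fun a => ?_⟩, fun a => ?_⟩
      · rw [map_add, map_add, ghostD_ghostD, add_zero, ← sub_sub, map_sub, hv' a, ← map_sub]
        congr 1
        simp only [map_sum, map_smul, smul_sub, Finset.sum_sub_distrib]
      · rw [map_add, map_add, ghostTrunc_ghostD, he', map_sum]
        simp only [map_smul, hs', add_assoc]
        rw [← hs a, map_sub]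
        abel
    · intro s hs
      choose y hy using fun a => exists_ghostTrunc_eq (fun l => s l a) (fun l => hs l a)
      exact ⟨y, fun l a => hy a l⟩
    · rintro l y y' h ⟨v, hv⟩
      refine ⟨v, fun a => ?_⟩
      rw [← hv a, map_sub, map_sub]
      congr 1
      refine ghostTrunc_succ_eq_iff.2 ⟨?_, ?_⟩
      · rw [ghostTrunc_ghostD, ghostTrunc_ghostD, h a]
      · rw [ghostD_snd, ghostD_snd, h a]
  obtain ⟨v, hv⟩ := exists_eq_sum_smul_of_ghostTrunc r (fun a => z a - ghostD X i j hij (y a))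
    (fun l => by
      obtain ⟨v, hv⟩ := hy l
      exact ⟨v, fun a => (ghostTrunc_succ_eq_iff.1 (hv a)).1⟩)
  exact ⟨y, v, fun a => by rw [← hv a]; abel⟩

end Tower

/-! ### The ghost resolution and the cone of its augmentation. -/

section Resolution

variable {R : Type u} [Ring R] (X : CochainComplex (ModuleCat.{u} R) ℤ)

theorem ghostD_inr_snd {i j : ℤ} (h : i + 1 = j)
    (z : ∀ l, ghostTarget (ghostTower X l) i) :
    ((0, (ghostD X i j h (0, z)).2) : GhostLimit X j) = ghostD X i j h (0, z) :=
  Prod.ext (by rw [ghostD_fst]; exact (map_zero (X.d i j).hom).symm) rfl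

/-- The differential of the ghost resolution. -/
noncomputable def ghostResolutionD (n : ℤ) :
    ModuleCat.of R (∀ l, ghostTarget (ghostTower X l) (n + 1)) ⟶
      ModuleCat.of R (∀ l, ghostTarget (ghostTower X l) (n + 1 + 1)) :=
  ModuleCat.ofHom (-(LinearMap.snd R (X.X (n + 1 + 1))
    (∀ l, ghostTarget (ghostTower X l) (n + 1 + 1)) ∘ₗ ghostD X (n + 1) (n + 1 + 1) rfl ∘ₗ
      LinearMap.inr R (X.X (n + 1)) (∀ l, ghostTarget (ghostTower X l) (n + 1))))

/-- The kernel of the projection from the limit of the ghost tower to `X`, shifted by one. -/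
noncomputable def ghostResolution : CochainComplex (ModuleCat.{u} R) ℤ :=
  CochainComplex.of (fun n => ModuleCat.of R (∀ l, ghostTarget (ghostTower X l) (n + 1)))
    (ghostResolutionD X) (fun n => by
      refine ModuleCat.hom_ext (LinearMap.ext fun z => ?_)
      change -(ghostD X (n + 1 + 1) (n + 1 + 1 + 1) rfl
        (0, -(ghostD X (n + 1) (n + 1 + 1) rfl (0, z)).2)).2 = 0
      have h : ((0, -(ghostD X (n + 1) (n + 1 + 1) rfl (0, z)).2) : GhostLimit X (n + 1 + 1)) =
          -ghostD X (n + 1) (n + 1 + 1) rfl (0, z) := by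
        conv_rhs => rw [← ghostD_inr_snd]
        rw [Prod.neg_mk, neg_zero]
      rw [h, map_neg, ghostD_ghostD, neg_zero, Prod.snd_zero, neg_zero])

theorem ghostResolution_d_apply {i j : ℤ} (h : i + 1 = j)
    (z : ∀ l, ghostTarget (ghostTower X l) (i + 1)) :
    ((ghostResolution X).d i j).hom z =
      (-(ghostD X (i + 1) (j + 1) (by lia) (0, z)).2 :
        ∀ l, ghostTarget (ghostTower X l) (j + 1)) := by
  subst h
  have h := CochainComplex.of_d (fun n => ModuleCat.of R (∀ l, ghostTarget (ghostTower X l) (n + 1)))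
    (ghostResolutionD X) i
  exact LinearMap.congr_fun (congrArg ModuleCat.Hom.hom h) z

/-- The augmentation of the ghost resolution. -/
noncomputable def ghostResolutionι : X ⟶ ghostResolution X where
  f n := ModuleCat.ofHom (LinearMap.snd R (X.X (n + 1))
    (∀ l, ghostTarget (ghostTower X l) (n + 1)) ∘ₗ ghostD X n (n + 1) rfl ∘ₗ
      LinearMap.inl R (X.X n) (∀ l, ghostTarget (ghostTower X l) n))
  comm' := by
    rintro i _ rfl
    refine ModuleCat.hom_ext (LinearMap.ext fun x => ?_)
    refine (ghostResolution_d_apply X rfl (ghostD X i (i + 1) rfl (x, 0)).2).trans ?_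
    change _ = (ghostD X (i + 1) (i + 1 + 1) rfl ((X.d i (i + 1)).hom x, 0)).2
    have h : ghostD X (i + 1) (i + 1 + 1) rfl ((X.d i (i + 1)).hom x, 0) +
        ghostD X (i + 1) (i + 1 + 1) rfl (0, (ghostD X i (i + 1) rfl (x, 0)).2) = 0 := by
      rw [← map_add, Prod.mk_add_mk, add_zero, zero_add]
      exact ghostD_ghostD rfl rfl (x, 0)
    rw [eq_neg_of_add_eq_zero_left h]
    rfl

open CochainComplex in
/-- The mapping cone of the augmentation is the shifted limit of the ghost tower. -/
noncomputable def coneToGhostLimit (j : ℤ) :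
    (mappingCone (ghostResolutionι X)).X j →ₗ[R] GhostLimit X (j + 1) :=
  ((mappingCone.fst (ghostResolutionι X)).1.v j (j + 1) rfl).hom.prod
    (-((mappingCone.snd (ghostResolutionι X)).v j j (add_zero j)).hom :
      (mappingCone (ghostResolutionι X)).X j →ₗ[R]
        ((ghostResolution X).X j : Type u))

open CochainComplex in
theorem coneToGhostLimit_injective (j : ℤ) :
    Function.Injective (coneToGhostLimit X j) := by
  intro c c' h
  have h1 := congrArg Prod.fst h
  have h2 := neg_injective (congrArg Prod.snd h)
  have hid := mappingCone.id_X (ghostResolutionι X) j (j + 1) rfl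
  have hc : ∀ c : (mappingCone (ghostResolutionι X)).X j,
      c = ((mappingCone.inl (ghostResolutionι X)).v (j + 1) j (by lia)).hom
          (((mappingCone.fst (ghostResolutionι X)).1.v j (j + 1) rfl).hom c) +
        ((mappingCone.inr (ghostResolutionι X)).f j).hom
          (((mappingCone.snd (ghostResolutionι X)).v j j (add_zero j)).hom c) := fun c =>
    (LinearMap.congr_fun (congrArg ModuleCat.Hom.hom hid) c).symm
  rw [hc c, hc c']
  exact congrArg₂ (fun a b => ((mappingCone.inl (ghostResolutionι X)).v (j + 1) j (by lia)).hom a +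
    ((mappingCone.inr (ghostResolutionι X)).f j).hom b) h1 h2

open CochainComplex in
theorem coneToGhostLimit_surjective (j : ℤ) :
    Function.Surjective (coneToGhostLimit X j) := by
  intro y
  refine ⟨((mappingCone.inl (ghostResolutionι X)).v (j + 1) j (by lia)).hom y.1 +
    ((mappingCone.inr (ghostResolutionι X)).f j).hom (-y.2 : ∀ l, _), ?_⟩
  have h11 := mappingCone.inl_v_fst_v (ghostResolutionι X) (j + 1) j rfl
  have h12 := mappingCone.inl_v_snd_v (ghostResolutionι X) (j + 1) j (by lia)
  have h21 := mappingCone.inr_f_fst_v (ghostResolutionι X) j (j + 1) rfl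
  have h22 := mappingCone.inr_f_snd_v (ghostResolutionι X) j
  rw [map_add]
  refine Prod.ext ?_ ?_
  · have e1 := LinearMap.congr_fun (congrArg ModuleCat.Hom.hom h11) y.1
    have e2 := LinearMap.congr_fun (congrArg ModuleCat.Hom.hom h21) (-y.2 : ∀ l, _)
    exact (congrArg₂ (· + ·) e1 e2).trans (add_zero _)
  · have e1 := LinearMap.congr_fun (congrArg ModuleCat.Hom.hom h12) y.1
    have e2 := LinearMap.congr_fun (congrArg ModuleCat.Hom.hom h22) (-y.2 : ∀ l, _)
    refine (congrArg₂ (fun a b => -a + -b) e1 e2).trans ?_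
    change -(0 : ∀ l, ghostTarget (ghostTower X l) (j + 1)) + -(-y.2) = y.2
    rw [neg_zero, zero_add, neg_neg]

open CochainComplex in
-- The sign on the second coordinate of `coneToGhostLimit` makes the cone match the limit with the
-- usual sign of a shift.
theorem coneToGhostLimit_d {i j : ℤ} (h : i + 1 = j) (c : (mappingCone (ghostResolutionι X)).X i) :
    coneToGhostLimit X j (((mappingCone (ghostResolutionι X)).d i j).hom c) =
      -ghostD X (i + 1) (j + 1) (by lia) (coneToGhostLimit X i c) := by
  subst h
  have h1 := LinearMap.congr_fun (congrArg ModuleCat.Hom.hom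
    (mappingCone.d_fst_v (ghostResolutionι X) i (i + 1) (i + 1 + 1) rfl rfl)) c
  have h2 := LinearMap.congr_fun (congrArg ModuleCat.Hom.hom
    (mappingCone.d_snd_v (ghostResolutionι X) i (i + 1) rfl)) c
  refine Prod.ext h1 ?_
  refine (congrArg Neg.neg h2).trans ?_
  let x : X.X (i + 1) := ((mappingCone.fst (ghostResolutionι X)).1.v i (i + 1) rfl).hom c
  let z : ∀ l, ghostTarget (ghostTower X l) (i + 1) :=
    ((mappingCone.snd (ghostResolutionι X)).v i i (add_zero i)).hom c
  let dz : ∀ l, ghostTarget (ghostTower X l) (i + 1 + 1) := ((ghostResolution X).d i (i + 1)).hom z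
  have hdz : dz = -(ghostD X (i + 1) (i + 1 + 1) rfl (0, z)).2 := ghostResolution_d_apply X rfl z
  change -((ghostD X (i + 1) (i + 1 + 1) rfl (x, 0)).2 + dz) = -(ghostD X (i + 1) (i + 1 + 1) rfl (x, -z)).2
  have h3 : ((x, -z) : GhostLimit X (i + 1)) = (x, 0) - (0, z) := by
    rw [Prod.mk_sub_mk, sub_zero, zero_sub]
  rw [hdz, h3, map_sub, Prod.snd_sub, sub_eq_add_neg]

theorem isPureQuasiIso_ghostResolutionι : IsPureQuasiIso (ghostResolutionι X) := by
  refine isPureExact_of_tupleExact _ fun i => ?_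
  intro q p r b w hb
  obtain ⟨e, v, hv⟩ := tupleExact_ghostD (X := X) (i := i + 1) (j := i + 1 + 1)
    (k := i + 1 + 1 + 1) rfl rfl r (fun a => coneToGhostLimit X _ (b a))
    (fun c => -coneToGhostLimit X _ (w c)) (fun a => by
      have h := congrArg (coneToGhostLimit X _) (hb a)
      rw [coneToGhostLimit_d _ rfl, map_sum] at h
      rw [← neg_eq_iff_eq_neg.2 h.symm]
      simp)
  choose e' he' using fun a => coneToGhostLimit_surjective X i (-e a)
  choose v' hv' using fun c => coneToGhostLimit_surjective X (i + 1) (v c)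
  refine ⟨e', v', fun a => coneToGhostLimit_injective X _ ?_⟩
  rw [hv a, map_add, coneToGhostLimit_d _ rfl, he', map_neg, neg_neg, map_sum]
  simp only [map_smul, hv']

theorem isPureInjective_ghostResolution (n : ℤ) : IsPureInjective ((ghostResolution X).X n) :=
  isPureInjective_pi (fun l => ghostTarget (ghostTower X l) (n + 1)) fun _ =>
    (isTuplePureInjective_ghostTarget _ _).isPureInjective

end Resolution

/-! ### Strictly triangular differentials and extension from cycles. -/

section Triangular

variable {R : Type u} [Ring R]

/-- A complex which is a product of graded modules in each degree, with strictly lower triangular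
differential. -/
structure IsTriangular (I : CochainComplex (ModuleCat.{v} R) ℤ) (Z : ℕ → ℤ → ModuleCat.{v} R)
    (π : ∀ l n, I.X n ⟶ Z l n) : Prop where
  exists_lift : ∀ {A : ModuleCat.{v} R} {n : ℤ} (g : ∀ l, A ⟶ Z l n),
    ∃ h : A ⟶ I.X n, ∀ l, h ≫ π l n = g l
  hom_ext : ∀ {A : ModuleCat.{v} R} {n : ℤ} (h h' : A ⟶ I.X n),
    (∀ l, h ≫ π l n = h' ≫ π l n) → h = h'
  d_comp : ∀ {A : ModuleCat.{v} R} (n m : ℤ) (h : A ⟶ I.X n) (l : ℕ),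
    (∀ j < l, h ≫ π j n = 0) → h ≫ I.d n m ≫ π l m = 0

/-- The components of the ghost resolution. -/
noncomputable def ghostResolutionπ (X : CochainComplex (ModuleCat.{u} R) ℤ) (l : ℕ) (n : ℤ) :
    (ghostResolution X).X n ⟶ ghostTarget (ghostTower X l) (n + 1) :=
  ModuleCat.ofHom (LinearMap.proj (φ := fun l => ghostTarget (ghostTower X l) (n + 1)) l)

/-- Component `l` of the differential factors through `ghostTrunc X l`, which sees only the `X`
part, zero here, and the factors of index below `l`. -/
theorem ghostResolution_isTriangular (X : CochainComplex (ModuleCat.{u} R) ℤ) :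
    IsTriangular (ghostResolution X) (fun l n => ghostTarget (ghostTower X l) (n + 1))
      (ghostResolutionπ X) where
  exists_lift g := ⟨ModuleCat.ofHom (LinearMap.pi fun l => (g l).hom), fun _ => rfl⟩
  hom_ext h h' hh := ModuleCat.hom_ext (LinearMap.ext fun x => funext fun l =>
    LinearMap.congr_fun (congrArg ModuleCat.Hom.hom (hh l)) x)
  d_comp {A} n m h l hl := by
    by_cases hnm : n + 1 = m
    · refine ModuleCat.hom_ext (LinearMap.ext fun x => ?_)
      refine (congrFun (ghostResolution_d_apply X hnm (h.hom x)) l).trans ?_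
      rw [Pi.neg_apply, ghostD_snd]
      have : ghostTrunc X l (n + 1) (0, h.hom x) = ghostTrunc X l (n + 1) 0 :=
        ghostTrunc_eq_of_forall_lt rfl fun j hj =>
          LinearMap.congr_fun (congrArg ModuleCat.Hom.hom (hl j hj)) x
      rw [this, map_zero, map_zero, neg_zero]
      rfl
    · have h0 : (ghostResolution X).d n m = 0 := HomologicalComplex.shape _ _ _ hnm
      refine ModuleCat.hom_ext (LinearMap.ext fun x => ?_)
      exact congrFun (LinearMap.congr_fun (congrArg ModuleCat.Hom.hom h0) (h.hom x)) l

/-- Extension of tuples of maps annihilating the boundaries of a pure exact complex. -/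
theorem IsPureExact.exists_extension {E : CochainComplex (ModuleCat.{v} R) ℤ} (hE : IsPureExact E)
    {J : ModuleCat.{v} R} (hJ : IsTuplePureInjective J) {i j k : ℤ} (hij : i + 1 = j)
    (hjk : j + 1 = k) {q p : ℕ} (r : Fin q → Fin p → ℤ) (g : Fin p → (E.X j ⟶ J))
    (hg : ∀ a, E.d i j ≫ g a = 0) (hr : ∀ b, ∑ a, r b a • g a = 0) :
    ∃ h : Fin p → (E.X k ⟶ J), (∀ a, E.d j k ≫ h a = g a) ∧ ∀ b, ∑ a, r b a • h a = 0 := by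
  -- Maps killing boundaries factor through `E^j / B^j`, which `d` identifies with the cycles `K`;
  -- the inclusion of `K` in `E^k` is pure.
  let K := LinearMap.ker (E.d k (k + 1)).hom
  let s : E.X j →ₗ[R] K := (E.d j k).hom.codRestrict K fun x =>
    LinearMap.congr_fun (congrArg ModuleCat.Hom.hom (E.d_comp_d j k (k + 1))) x
  have hs : Function.Surjective s := by
    rintro ⟨y, hy⟩
    have hy' : y ∈ LinearMap.range (E.d j k).hom := by
      rw [← (hE k).exact hjk rfl]
      exact hy
    obtain ⟨x, rfl⟩ := hy'
    exact ⟨x, rfl⟩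
  have hker : ∀ a, LinearMap.ker s ≤ LinearMap.ker (g a).hom := fun a x hx => by
    have hx' : x ∈ LinearMap.ker (E.d j k).hom := congrArg Subtype.val hx
    rw [(hE j).exact hij hjk] at hx'
    obtain ⟨y, rfl⟩ := hx'
    exact LinearMap.congr_fun (congrArg ModuleCat.Hom.hom (hg a)) y
  have hlift : ∀ a, ∃ t : K →ₗ[R] J, t ∘ₗ s = (g a).hom := fun a =>
    ⟨(LinearMap.ker s).liftQ (g a).hom (hker a) ∘ₗ (s.quotKerEquivOfSurjective hs).symm, by
      ext x
      have : (s.quotKerEquivOfSurjective hs).symm (s x) = Submodule.Quotient.mk x :=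
        (LinearEquiv.symm_apply_eq _).2 rfl
      rw [LinearMap.comp_apply, LinearMap.comp_apply, LinearEquiv.coe_coe, this]
      rfl⟩
  choose t ht using hlift
  obtain ⟨h, hh, hh'⟩ := hJ r _ ((hE k).isPureMono_ker rfl) (fun a => ModuleCat.ofHom (t a))
    (fun b => by
      refine ModuleCat.hom_ext (LinearMap.ext fun y => ?_)
      obtain ⟨x, rfl⟩ := hs y
      have h0 := LinearMap.congr_fun (congrArg ModuleCat.Hom.hom (hr b)) x
      simp only [ModuleCat.hom_sum, LinearMap.sum_apply, ModuleCat.hom_zsmul,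
        LinearMap.smul_apply, ← ht] at h0 ⊢
      exact h0)
  refine ⟨h, fun a => ?_, hh'⟩
  refine ModuleCat.hom_ext (LinearMap.ext fun x => ?_)
  exact (LinearMap.congr_fun (congrArg ModuleCat.Hom.hom (hh a)) (s x)).trans
    (LinearMap.congr_fun (ht a) x)

end Triangular

/-! ### Pure exactness of the Hom complex. -/

section HomTriangular

open CochainComplex CochainComplex.HomComplex

variable {R : Type u} [Ring R] {E I : CochainComplex (ModuleCat.{v} R) ℤ}
  {Z : ℕ → ℤ → ModuleCat.{v} R} (π : ∀ l n, I.X n ⟶ Z l n)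

/-- The components of a cochain with values in a product. -/
def cochainComponent (l : ℕ) {n : ℤ} (a b : ℤ) (h : a + n = b) :
    Cochain E I n →+ (E.X a ⟶ Z l b) :=
  AddMonoidHom.mk' (fun φ => φ.v a b h ≫ π l b) (fun φ ψ => by
    rw [Cochain.add_v, Preadditive.add_comp])

theorem cochainComponent_apply (l : ℕ) {n : ℤ} (a b : ℤ) (h : a + n = b) (φ : Cochain E I n) :
    cochainComponent π l a b h φ = φ.v a b h ≫ π l b := rfl

/-- The components of index less than `l` of a cochain vanish. -/
def VanishesBelow (l : ℕ) {n : ℤ} (φ : Cochain E I n) : Prop :=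
  ∀ j < l, ∀ (a b : ℤ) (h : a + n = b), cochainComponent π j a b h φ = 0

variable {π}

theorem VanishesBelow.sub {l : ℕ} {n : ℤ} {φ ψ : Cochain E I n} (hφ : VanishesBelow π l φ)
    (hψ : VanishesBelow π l ψ) : VanishesBelow π l (φ - ψ) := fun j hj a b h => by
  rw [map_sub, hφ j hj, hψ j hj, sub_zero]

theorem VanishesBelow.add {l : ℕ} {n : ℤ} {φ ψ : Cochain E I n} (hφ : VanishesBelow π l φ)
    (hψ : VanishesBelow π l ψ) : VanishesBelow π l (φ + ψ) := fun j hj a b h => by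
  rw [map_add, hφ j hj, hψ j hj, add_zero]

theorem VanishesBelow.zsmul {l : ℕ} {n : ℤ} {φ : Cochain E I n} (hφ : VanishesBelow π l φ)
    (m : ℤ) : VanishesBelow π l (m • φ) := fun j hj a b h => by
  rw [map_zsmul, hφ j hj, smul_zero]

theorem VanishesBelow.sum {l : ℕ} {n : ℤ} {ι : Type*} {s : Finset ι} {φ : ι → Cochain E I n}
    (hφ : ∀ i, VanishesBelow π l (φ i)) : VanishesBelow π l (∑ i ∈ s, φ i) := fun j hj a b h => by
  rw [map_sum]
  exact Finset.sum_eq_zero fun i _ => hφ i j hj a b h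

theorem vanishesBelow_zero (l : ℕ) {n : ℤ} : VanishesBelow π l (0 : Cochain E I n) :=
  fun _ _ _ _ _ => map_zero _

theorem VanishesBelow.mono {l l' : ℕ} (hl : l ≤ l') {n : ℤ} {φ : Cochain E I n}
    (hφ : VanishesBelow π l' φ) : VanishesBelow π l φ :=
  fun j hj => hφ j (hj.trans_le hl)

theorem VanishesBelow.of_sub {l : ℕ} {n : ℤ} {φ ψ : Cochain E I n} (hφ : VanishesBelow π l φ)
    (hψ : VanishesBelow π l (φ - ψ)) : VanishesBelow π l ψ := by
  have := hφ.sub hψ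
  rwa [sub_sub_cancel] at this

namespace IsTriangular

theorem cochain_ext (hI : IsTriangular I Z π) {n : ℤ} {φ : Cochain E I n}
    (h : ∀ l, VanishesBelow π l φ) : φ = 0 := by
  refine Cochain.ext _ _ fun a b hab => ?_
  refine hI.hom_ext _ _ fun l => ?_
  rw [Cochain.zero_v, Limits.zero_comp]
  exact h (l + 1) l (by lia) a b hab

theorem exists_cochain (hI : IsTriangular I Z π) {n : ℤ}
    (g : ∀ (l : ℕ) (a b : ℤ), a + n = b → (E.X a ⟶ Z l b)) :
    ∃ φ : Cochain E I n, ∀ l a b h, cochainComponent π l a b h φ = g l a b h := by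
  choose f hf using fun (a b : ℤ) (h : a + n = b) => hI.exists_lift fun l => g l a b h
  exact ⟨Cochain.mk f, fun l a b h => by rw [cochainComponent_apply, Cochain.mk_v, hf]⟩

/-- Triangularity kills the `d_I` term in component `l`, leaving precomposition with `d_E`. -/
theorem component_δ (hI : IsTriangular I Z π) {n m : ℤ} (hnm : n + 1 = m) {l : ℕ}
    {φ : Cochain E I n} (hφ : VanishesBelow π l φ) (a b a' : ℤ) (h : a + m = b)
    (ha : a + 1 = a') :
    cochainComponent π l a b h (δ n m φ) =
      m.negOnePow • E.d a a' ≫ cochainComponent π l a' b (by lia) φ := by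
  rw [cochainComponent_apply, δ_v n m hnm φ a b h (b - 1) a' rfl ha, Preadditive.add_comp,
    Category.assoc, hI.d_comp _ _ _ l fun j hj => hφ j hj _ _ _, zero_add,
    Linear.units_smul_comp, Category.assoc]
  rfl

theorem vanishesBelow_δ (hI : IsTriangular I Z π) {n m : ℤ} (hnm : n + 1 = m) {l : ℕ}
    {φ : Cochain E I n} (hφ : VanishesBelow π l φ) : VanishesBelow π l (δ n m φ) :=
  fun j hj a b h => by
    rw [hI.component_δ hnm (hφ.mono hj.le) a b (a + 1) h rfl, hφ j hj, Limits.comp_zero, smul_zero]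

/-- By `component_δ`, component `l` of such a cocycle kills the boundaries of `E`, so it extends
through `d_E`. A correction placed in component `l` alone disturbs nothing below. -/
theorem exists_approximation (hI : IsTriangular I Z π) (hZ : ∀ l n, IsTuplePureInjective (Z l n))
    (hE : IsPureExact E) {n m k : ℤ} (hnm : n + 1 = m) (hmk : m + 1 = k) {q p : ℕ}
    (r : Fin q → Fin p → ℤ) (l : ℕ) (φ : Fin p → Cochain E I m)
    (hφ : ∀ i, VanishesBelow π l (φ i)) (hδ : ∀ i, δ m k (φ i) = 0)
    (hr : ∀ c, ∑ i, r c i • φ i = 0) :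
    ∃ ψ : Fin p → Cochain E I n, (∀ i, VanishesBelow π l (ψ i)) ∧
      (∀ i, VanishesBelow π (l + 1) (φ i - δ n m (ψ i))) ∧ ∀ c, ∑ i, r c i • ψ i = 0 := by
  classical
  have hext : ∀ (a b : ℤ) (_ : a + n = b), ∃ h : Fin p → (E.X a ⟶ Z l b),
      (∀ i, E.d (a - 1) a ≫ h i = cochainComponent π l (a - 1) b (by lia) (φ i)) ∧
        ∀ c, ∑ i, r c i • h i = 0 := fun a b hab => by
    refine hE.exists_extension (hZ l b) (i := a - 2) (by lia) (by lia) r _ (fun i => ?_)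
      (fun c => ?_)
    · have h0 := hI.component_δ hmk (hφ i) (a - 2) b (a - 1) (by lia) (by lia)
      rw [hδ, map_zero, eq_comm, smul_eq_zero_iff_eq] at h0
      exact h0
    · simp only [← map_zsmul, ← map_sum, hr c, map_zero]
  choose h hh hh' using hext
  choose ψ hψ using fun i => hI.exists_cochain (E := E) (n := n) fun j a b hab =>
    (Pi.single l (m.negOnePow • h a b hab i) : ∀ j, E.X a ⟶ Z j b) j
  have hψl : ∀ i, VanishesBelow π l (ψ i) := fun i j hj a b hab => by
    rw [hψ, Pi.single_eq_of_ne hj.ne]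
  refine ⟨ψ, hψl, fun i j hj a b hab => ?_, fun c => hI.cochain_ext fun l' j _ a b hab => ?_⟩
  · rw [map_sub]
    rcases Nat.lt_succ_iff_lt_or_eq.1 hj with hj | rfl
    · rw [hφ i j hj, hI.vanishesBelow_δ hnm (hψl i) j hj, sub_zero]
    · rw [hI.component_δ hnm (hψl i) a b (a + 1) hab rfl, hψ, Pi.single_eq_same,
        Linear.comp_units_smul, smul_smul, Int.units_mul_self, one_smul, sub_eq_zero]
      have := hh (a + 1) b (by lia) i
      -- Transport along `a + 1 - 1 = a`.
      have e : ∀ a' (ha : a' = a) (h1 : a' + m = b) ,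
          E.d a' (a + 1) ≫ h (a + 1) b (by lia) i = cochainComponent π j a' b h1 (φ i) →
          cochainComponent π j a b hab (φ i) = E.d a (a + 1) ≫ h (a + 1) b (by lia) i := by
        rintro _ rfl _ h
        exact h.symm
      exact e _ (by lia) _ this
  · rw [map_sum]
    simp only [map_zsmul, hψ]
    by_cases hj : j = l
    · subst hj
      simp only [Pi.single_eq_same]
      simp only [smul_comm _ m.negOnePow, ← Finset.smul_sum, hh', smul_zero]
    · simp only [Pi.single_eq_of_ne hj, smul_zero, Finset.sum_const_zero]

/-- Exactness of `Hom(E, I)` on tuples annihilated by an integer matrix. -/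
theorem exists_δ_eq (hI : IsTriangular I Z π) (hZ : ∀ l n, IsTuplePureInjective (Z l n))
    (hE : IsPureExact E) {n m k : ℤ} (hnm : n + 1 = m) (hmk : m + 1 = k) {q p : ℕ}
    (r : Fin q → Fin p → ℤ) (φ : Fin p → Cochain E I m) (hδ : ∀ i, δ m k (φ i) = 0)
    (hr : ∀ c, ∑ i, r c i • φ i = 0) :
    ∃ ψ : Fin p → Cochain E I n, (∀ i, δ n m (ψ i) = φ i) ∧ ∀ c, ∑ i, r c i • ψ i = 0 := by
  let S : ℕ → (Fin p → Cochain E I n) → Prop := fun l ψ =>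
    (∀ i, VanishesBelow π l (φ i - δ n m (ψ i))) ∧ ∀ c, VanishesBelow π l (∑ i, r c i • ψ i)
  obtain ⟨ψ, hψ⟩ : ∃ ψ, ∀ l, S l ψ := by
    refine exists_forall_of_approximations (fun l ψ ψ' => ∀ i, VanishesBelow π l (ψ i - ψ' i)) S
      ⟨0, fun _ j hj => absurd hj (by lia), fun _ j hj => absurd hj (by lia)⟩ ?_ ?_ ?_
    · rintro l ψ ⟨h1, h2⟩
      -- The relations hold for `ψ` only below `l`. Its truncation `τ` satisfies them exactly, so
      -- `exists_approximation` applies to `φ - δ τ`.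
      choose τ hτ using fun i => hI.exists_cochain (E := E) (n := n) fun j a b hab =>
        if j < l then cochainComponent π j a b hab (ψ i) else 0
      have hψτ : ∀ i, VanishesBelow π l (ψ i - τ i) := fun i j hj a b hab => by
        rw [map_sub, hτ, if_pos hj, sub_self]
      have hrτ : ∀ c, ∑ i, r c i • τ i = 0 := fun c => hI.cochain_ext fun l' j _ a b hab => by
        rw [map_sum]
        simp only [map_zsmul, hτ]
        by_cases hj : j < l
        · simp only [if_pos hj, ← map_zsmul, ← map_sum]
          exact h2 c j hj a b hab
        · simp only [if_neg hj, smul_zero, Finset.sum_const_zero]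
      have hφτ : ∀ i, VanishesBelow π l (φ i - δ n m (τ i)) := fun i => by
        have := (h1 i).add (hI.vanishesBelow_δ hnm (hψτ i))
        rwa [δ_sub, sub_add_sub_cancel] at this
      obtain ⟨χ, hχ, hχ', hχr⟩ := hI.exists_approximation hZ hE hnm hmk r l
        (fun i => φ i - δ n m (τ i)) hφτ
        (fun i => by rw [δ_sub, hδ, δ_δ, sub_zero])
        (fun c => by
          have h0 : δ n m (∑ i, r c i • τ i) = ∑ i, r c i • δ n m (τ i) := by
            have := map_sum (δ_hom ℤ E I n m) (fun i => r c i • τ i) Finset.univ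
            simpa only [map_zsmul] using! this
          simp only [smul_sub, Finset.sum_sub_distrib]
          rw [hr, ← h0, hrτ, δ_zero, sub_zero])
      refine ⟨fun i => τ i + χ i, ⟨fun i => ?_, fun c => ?_⟩, fun i => ?_⟩
      · rw [δ_add, ← sub_sub]
        exact hχ' i
      · simp only [smul_add, Finset.sum_add_distrib]
        rw [hrτ, hχr, add_zero]
        exact vanishesBelow_zero _
      · rw [← sub_sub]
        exact (hψτ i).sub (hχ i)
    · intro s hs
      choose ψ hψ using fun i => hI.exists_cochain (E := E) (n := n) fun j a b hab =>
        cochainComponent π j a b hab (s (j + 1) i)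
      refine ⟨ψ, fun l i j hj a b hab => ?_⟩
      rw [map_sub, hψ, sub_eq_zero]
      induction l, Nat.succ_le_of_lt hj using Nat.le_induction with
      | base => rfl
      | succ l hl ih =>
        rw [← ih (by lia), eq_comm, ← sub_eq_zero, ← map_sub]
        exact hs l i j (by lia) a b hab
    · rintro l ψ ψ' h ⟨h1, h2⟩
      refine ⟨fun i => ?_, fun c => ?_⟩
      · have := (h1 i).add (hI.vanishesBelow_δ hnm (h i))
        rwa [δ_sub, sub_add_sub_cancel] at this
      · refine (h2 c).of_sub ?_
        rw [← Finset.sum_sub_distrib]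
        simp only [← smul_sub]
        exact VanishesBelow.sum fun i => (h i).zsmul _
  exact ⟨ψ, fun i => (sub_eq_zero.1 (hI.cochain_ext fun l => (hψ l).1 i)).symm,
    fun c => hI.cochain_ext fun l => (hψ l).2 c⟩

/-- `exists_δ_eq` gives exactness on annihilated tuples in every degree, and three consecutive
degrees feed `TupleExact.of_annihilated` over `ℤ`. -/
theorem isPureExact_homComplex (hI : IsTriangular I Z π)
    (hZ : ∀ l n, IsTuplePureInjective (Z l n)) (hE : IsPureExact E) :
    IsPureExact (homComplex E I) := by
  refine isPureExact_of_tupleExact _ fun i => ?_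
  have key : ∀ n m k : ℤ, n + 1 = m → m + 1 = k → ∀ ⦃q p : ℕ⦄ (r : Fin q → Fin p → ℤ)
      (c : Fin p → (homComplex E I).X m), (∀ i, ((homComplex E I).d m k).hom (c i) = 0) →
      (∀ l, ∑ i, r l i • c i = 0) →
      ∃ b : Fin p → (homComplex E I).X n, (∀ i, ((homComplex E I).d n m).hom (b i) = c i) ∧
        ∀ l, ∑ i, r l i • b i = 0 := fun n m k hnm hmk q p r c hc hr =>
    hI.exists_δ_eq hZ hE hnm hmk r c hc hr
  refine TupleExact.of_annihilated
    (k := ((homComplex E I).d (i + 1 + 1) (i + 1 + 1 + 1)).hom) ?_ ?_ ?_ ?_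
  · rw [← ModuleCat.hom_comp, HomologicalComplex.d_comp_d, ModuleCat.hom_zero]
  · intro b hb
    obtain ⟨a, ha, -⟩ := key i (i + 1) (i + 1 + 1) rfl rfl (q := 0) (p := 1) Fin.elim0
      (fun _ => b) (fun _ => hb) (fun l => l.elim0)
    exact ⟨a 0, ha 0⟩
  · intro q p r c hc hr
    exact key (i + 1) (i + 1 + 1) (i + 1 + 1 + 1) rfl rfl r c hc hr
  · intro q p r d hd hr
    refine key (i + 1 + 1) (i + 1 + 1 + 1) (i + 1 + 1 + 1 + 1) rfl rfl r d (fun j => ?_) hr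
    obtain ⟨c, hc⟩ := hd j
    rw [← hc]
    exact LinearMap.congr_fun
      (congrArg ModuleCat.Hom.hom ((homComplex E I).d_comp_d _ _ (i + 1 + 1 + 1 + 1))) c

end IsTriangular

end HomTriangular

/-- Every complex, bounded or not, has a pure injective resolution: the ghost resolution. -/
theorem isPureInjectiveResolution_ghostResolutionι {R : Type u} [Ring R]
    (X : CochainComplex (ModuleCat.{u} R) ℤ) :
    IsPureInjectiveResolution (ghostResolutionι X) where
  quasiIso := isPureQuasiIso_ghostResolutionι X
  pureInjective := isPureInjective_ghostResolution X
  hom_pureExact _ hE := (ghostResolution_isTriangular X).isPureExact_homComplex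
    (fun _ _ => isTuplePureInjective_ghostTarget _ _) hE

end PureHomology

/-- The resolution constructed above does not need the boundedness hypothesis. -/
theorem theorem5p2 {R : Type u} [Ring R] (X : CochainComplex (ModuleCat.{u} R) ℤ)
    (hX : ∃ b : ℤ, ∀ i : ℤ, b < i → Limits.IsZero (X.X i)) :
    ∃ (I : CochainComplex (ModuleCat.{u} R) ℤ) (f : X ⟶ I),
      PureHomology.IsPureInjectiveResolution f :=
  ⟨_, _, PureHomology.isPureInjectiveResolution_ghostResolutionι X⟩
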